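/- Let $T,\beta,\sigma>0$ and let $E=C([0,T])$ with the sup-norm $\|\cdot\|$. Let $X=(X_t)_{t\in[0,T]}$ be the stationary Ornstein–Uhlenbeck process, i.e. the continuous solution of $dX_t=-\beta X_t\,dt+\sigma\,dW_t$ with $W$ a standard Brownian motion and $X_0$ independent of $W$ with law $\mathcal N(0,\sigma^2/(2\beta))$. Definitions. Let $\xi_1,\xi_2,\dots$ be i.i.d. $\mathcal N(0,1)$. A sequence $(g_j)_{j\ge1}$ in $E$ is admissible for $X$ if $\sum_j\xi_jg_j$ converges a.s. in $E$ and has the same law as $X$. For real random variables, $\hat\xi$ is an $L^r$-optimal $n$-quantization of $\xi$ if it has at most $n$ values and minimizes $\mathbb E|\xi-\hat\xi|^r$ among random variables with at most $n$ values. An $L^r$-product $N$-quantization with respect to $(g_j)$ is a random vector $\hat X=\sum_{j=1}^m\hat\xi_jg_j$, where $m,N_1,\dots,N_m\ge1$ are integers with $\prod_{j=1}^m N_j\le N$ and $\hat\xi_j$ is an $L^r$-optimal $N_j$-quantization of $\xi_j$. Let $$e^{(\mathrm{prod})}_{N,r}(X)=\inf\Big\{\Big(\mathbb E\Big\|\sum_{j\ge1}\xi_jg_j-\hat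 X\Big\|^r\Big)^{1/r}\Big\},$$ where the infimum is over all $(g_j)$ admissible for $X$ and all $L^r$-product $N$-quantizations $\hat X$ with respect to $(g_j)$. Theorem. Let, for $t\in[0,T]$, $$f_0(t)=\frac{\sigma}{\sqrt{2\beta}}e^{-\beta t},\qquad f_j(t)=\sigma\sqrt{\tfrac2T}\int_0^te^{-\beta(t-s)}\cos\Big(\frac{\pi(j-1/2)s}{T}\Big)ds\quad(j\ge1),$$ and put $g_j=f_{j-1}$ for $j\ge1$. Then $(g_j)_{j\ge1}$ is admissible for $X$, and it satisfies the following two conditions with $\vartheta=1$, $\gamma=0$, $a=1$, $b=1$: there are finite constants $C_1,C_2$ such that for all $j\ge1$ (A1) $\|g_j\|\le C_1\,j^{-\vartheta}\,(\log(1+j))^{\gamma}$ (where $\vartheta>1/2$, $\gamma\ge0$); (A2) $|g_j(s)-g_j(t)|\le C_2\,j^{b}\,|s-t|^{a}$ for all $s,t\in[0,T]$ (where $a\in(0,1]$). Moreover, for every $r\in(0,\infty)$, as $N\to\infty$, $$e^{(\mathrm{prod})}_{N,r}(X)=O\left(\frac{\log\log N}{(\log N)^{1/2}}\right),$$ with a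 constant depending only on $T,\beta,\sigma,r$. -/

import Mathlib

open MeasureTheory ProbabilityTheory Filter Topology
open scoped ENNReal NNReal

noncomputable section

/-! ### Product quantization of random vectors

Sequences `(f_j)_{j ≥ 1}` and `(ξ_j)_{j ≥ 1}` are indexed by `ℕ`: the entry `j : ℕ` is the entry
number `j + 1`. -/

section Quantization

variable {Ω Ω' E : Type*} [MeasurableSpace Ω] [MeasurableSpace Ω']

/-- `ξ` is a sequence of i.i.d. standard normal random variables under `Q`. -/
def IsStdNormalSeq (ξ : ℕ → Ω' → ℝ) (Q : Measure Ω') : Prop :=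
  (∀ j, HasLaw (ξ j) (gaussianReal 0 1) Q) ∧ iIndepFun ξ Q

/-- The `L^r`-distance `(𝔼 ‖U - V‖ ^ r) ^ (1 / r)`, with value `∞` allowed. -/
def lrError [NormedAddCommGroup E] (U V : Ω' → E) (Q : Measure Ω') (r : ℝ) : ℝ≥0∞ :=
  (∫⁻ ω, ‖U ω - V ω‖ₑ ^ r ∂Q) ^ (1 / r)

/-- `Y` is an `N`-quantization: a random vector with at most `N` values. -/
def IsQuantization [MeasurableSpace E] (Y : Ω' → E) (N : ℕ) : Prop :=
  Measurable Y ∧ (Set.range Y).encard ≤ N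

/-- The minimal level `N` quantization error of `Z` in `L^r`. -/
def minQuantError [NormedAddCommGroup E] [MeasurableSpace E]
    (Z : Ω' → E) (Q : Measure Ω') (N : ℕ) (r : ℝ) : ℝ≥0∞ :=
  ⨅ (Y : Ω' → E) (_ : IsQuantization Y N), lrError Z Y Q r

/-- `Y` is an `L^r`-optimal `N`-quantization of `Z`. -/
def IsOptimalQuantization [NormedAddCommGroup E] [MeasurableSpace E]
    (Z Y : Ω' → E) (Q : Measure Ω') (N : ℕ) (r : ℝ) : Prop :=
  IsQuantization Y N ∧ lrError Z Y Q r = minQuantError Z Q N r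

variable [NormedAddCommGroup E] [NormedSpace ℝ E]

/-- The series `∑ ξ_j f_j` converges in `E` almost surely, with sum `S`. -/
def SumsTo (ξ : ℕ → Ω' → ℝ) (Q : Measure Ω') (f : ℕ → E) (S : Ω' → E) : Prop :=
  ∀ᵐ ω ∂Q, Tendsto (fun n => ∑ j ∈ Finset.range n, ξ j ω • f j) atTop (𝓝 (S ω))

/-- `f` is admissible for the random vector `X` (with respect to the i.i.d. standard normal
sequence `ξ`): `∑ ξ_j f_j` converges a.s. in `E` and has the same law as `X`. -/
def IsAdmissible [MeasurableSpace E] (ξ : ℕ → Ω' → ℝ) (Q : Measure Ω')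
    (X : Ω → E) (P : Measure Ω) (f : ℕ → E) : Prop :=
  ∃ S : Ω' → E, SumsTo ξ Q f S ∧ IdentDistrib X S P Q

/-- `Y` is an `L^r`-product `N`-quantization with respect to `f`: `Y = ∑_{j ≤ m} ξ̂_j f_j`, where
`ξ̂_j` is an `L^r`-optimal `N_j`-quantization of `ξ_j` and `N_1 ⋯ N_m ≤ N`. -/
def IsProductQuantization (ξ : ℕ → Ω' → ℝ) (Q : Measure Ω') (f : ℕ → E)
    (N : ℕ) (r : ℝ) (Y : Ω' → E) : Prop :=
  ∃ (m : ℕ) (M : ℕ → ℕ) (ξhat : ℕ → Ω' → ℝ), 1 ≤ m ∧ (∀ j < m, 1 ≤ M j) ∧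
    ∏ j ∈ Finset.range m, M j ≤ N ∧
    (∀ j < m, IsOptimalQuantization (ξ j) (ξhat j) Q (M j) r) ∧
    Y = fun ω => ∑ j ∈ Finset.range m, ξhat j ω • f j

/-- The minimal `N`-th product quantization error of `X`: the infimum of
`(𝔼 ‖S - Y‖ ^ r) ^ (1 / r)` over all `f` admissible for `X` and all `L^r`-product
`N`-quantizations `Y` with respect to `f`, where `S = ∑ ξ_j f_j` is the version of `X` expanded
along `f`. The infimum of the empty set is `∞`. -/
def minProdQuantError [MeasurableSpace E] (ξ : ℕ → Ω' → ℝ) (Q : Measure Ω')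
    (X : Ω → E) (P : Measure Ω) (N : ℕ) (r : ℝ) : ℝ≥0∞ :=
  ⨅ (f : ℕ → E) (_ : IsAdmissible ξ Q X P f) (S : Ω' → E) (_ : SumsTo ξ Q f S)
    (Y : Ω' → E) (_ : IsProductQuantization ξ Q f N r Y), lrError S Y Q r

end Quantization

/-! ### Continuous functions on `[0, T]` -/

/-- The path space `C([0, T])`, with the sup-norm. -/
abbrev PathSpace (T : ℝ) : Type := C(Set.Icc (0 : ℝ) T, ℝ)

instance instMeasurableSpacePathSpace (T : ℝ) : MeasurableSpace (PathSpace T) := borel _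

instance instBorelSpacePathSpace (T : ℝ) : BorelSpace (PathSpace T) := ⟨rfl⟩

/-- Condition (A1): `‖f_j‖ ≤ C₁ j ^ (-ϑ) log (1 + j) ^ γ` for all `j ≥ 1`. -/
def SatisfiesA1 {T : ℝ} (f : ℕ → PathSpace T) (ϑ γ : ℝ) : Prop :=
  1 / 2 < ϑ ∧ 0 ≤ γ ∧ ∃ C₁ : ℝ, ∀ j : ℕ,
    ‖f j‖ ≤ C₁ * ((j + 1 : ℕ) : ℝ) ^ (-ϑ) * Real.log (1 + ((j + 1 : ℕ) : ℝ)) ^ γ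

/-- Condition (A2): `f_j` is `a`-Hölder continuous with `[f_j]_a ≤ C₂ j ^ b` for all `j ≥ 1`. -/
def SatisfiesA2 {T : ℝ} (f : ℕ → PathSpace T) (a b : ℝ) : Prop :=
  0 < a ∧ a ≤ 1 ∧ ∃ C₂ : ℝ, ∀ (j : ℕ) (s t : Set.Icc (0 : ℝ) T),
    |f j s - f j t| ≤ C₂ * ((j + 1 : ℕ) : ℝ) ^ b * |(s : ℝ) - (t : ℝ)| ^ a

/-! ### The stationary Ornstein–Uhlenbeck process -/

/-- `X` is a stationary Ornstein–Uhlenbeck process on `[0, T]`: it has continuous paths and solves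
`dX_t = -β X_t dt + σ dW_t` for a standard Brownian motion `W`, and `X_0` is independent of `W`
with law `𝒩(0, σ² / (2 β))`. As the noise is additive, the equation is a pathwise integral
equation. -/
structure IsStationaryOU {Ω : Type*} [MeasurableSpace Ω] {T : ℝ} (hT : 0 ≤ T) (β σ : ℝ)
    (X : Ω → PathSpace T) (P : Measure Ω) : Prop where
  aemeasurable : ∀ t, AEMeasurable (fun ω => X ω t) P
  law_zero : HasLaw (fun ω => X ω ⟨0, Set.left_mem_Icc.2 hT⟩)
    (gaussianReal 0 (σ ^ 2 / (2 * β)).toNNReal) P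
  langevin : ∃ W : ℝ≥0 → Ω → ℝ, IsBrownianReal W P ∧
    IndepFun (fun ω => X ω ⟨0, Set.left_mem_Icc.2 hT⟩) (fun ω t => W t ω) P ∧
    ∀ᵐ ω ∂P, ∀ t : Set.Icc (0 : ℝ) T,
      X ω t = X ω ⟨0, Set.left_mem_Icc.2 hT⟩
        - β * (∫ s in (0 : ℝ)..t, Set.IccExtend hT (X ω) s) + σ * W (t : ℝ).toNNReal ω

/-- The sequence `f_0 (t) = σ / √(2 β) e ^ (-β t)` and, for `j ≥ 1`,
`f_j (t) = σ √(2 / T) ∫_0^t e ^ (-β (t - s)) cos (π (j - 1/2) s / T) ds`. -/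
def ouSeq (T β σ : ℝ) : ℕ → PathSpace T
  | 0 => ⟨fun t => σ / √(2 * β) * Real.exp (-β * t), by fun_prop⟩
  | j + 1 => ⟨fun t => σ * √(2 / T) * ∫ s in (0 : ℝ)..t,
      Real.exp (-β * (t - s)) * Real.cos (Real.pi * (((j + 1 : ℕ) : ℝ) - 1 / 2) * s / T), by
        refine continuous_const.mul
          (intervalIntegral.continuous_parametric_intervalIntegral_of_continuous ?_ ?_) <;>
        fun_prop⟩

end

/-! ### Gaussian sums -/

section Gaussian

variable {Ω : Type*} [MeasurableSpace Ω] {Q : Measure Ω}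

/-! Admissibility. The Langevin noise `x(t) - x(0) + β ∫₀ᵗ x` kills `f_0` and sends `f_{j+1}` to `σ`
times the `j`-th Karhunen–Loève function of Brownian motion, while it sends the process to `σ W`.
Together with `x(0)` it determines the path, so it suffices to compare linear combinations of these
coordinates. On both sides they are centred Gaussian, and `hasSum_sin_mul_sin` makes the variances
equal (`hasSum_coord_ouSeq_sq`, `IsStationaryOU.hasLaw_coord`,
`identDistrib_of_forall_langevinCoord`).

Rate. Since `‖f_j‖ = O(1/j)` and the Lipschitz constants grow at most linearly, a union bound over
blocks and grid points bounds all tails of the series at once by `√((Λ + log m) / m)` with `exp Λ`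
integrable (`exists_forall_norm_sum_Ico_le`). Keep `m ≈ log N / (q log log N)` coordinates and give
each of them the same level `m ^ q`. For `q` large the coordinate errors are negligible even under
crude estimates, so no optimal allocation of levels is needed, and the tail `√(log m / m)` is of
order `log log N / √(log N)` (`eventually_exists_product_level`, `exists_minProdQuantError_le`).
Optimal quantizations of a normal variable exist by compactness and Fatou's lemma
(`exists_isOptimalQuantization`). -/

lemma IsStdNormalSeq.isProbabilityMeasure {ξ : ℕ → Ω → ℝ} (h : IsStdNormalSeq ξ Q) :
    IsProbabilityMeasure Q :=
  (h.1 0).isProbabilityMeasure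

lemma IsStdNormalSeq.aemeasurable {ξ : ℕ → Ω → ℝ} (h : IsStdNormalSeq ξ Q) (j : ℕ) :
    AEMeasurable (ξ j) Q :=
  (h.1 j).aemeasurable

lemma IsStdNormalSeq.hasLaw_sum {ξ : ℕ → Ω → ℝ} (h : IsStdNormalSeq ξ Q) (c : ℕ → ℝ)
    (s : Finset ℕ) :
    HasLaw (fun ω => ∑ j ∈ s, c j * ξ j ω) (gaussianReal 0 (∑ j ∈ s, c j ^ 2).toNNReal) Q := by
  have := h.isProbabilityMeasure
  have hind : iIndepFun (fun j ω => c j * ξ j ω) Q :=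
    h.2.comp (fun j x => c j * x) (fun j => measurable_const_mul _)
  have hm : ∀ j, AEMeasurable (fun ω => c j * ξ j ω) Q := fun j => (h.aemeasurable j).const_mul _
  induction s using Finset.induction_on with
  | empty =>
    simp only [Finset.sum_empty, Real.toNNReal_zero, gaussianReal_zero_var]
    exact hasLaw_dirac_of_ae_eq (Eventually.of_forall fun _ => rfl)
  | insert a s ha ih =>
    have h1 := gaussianReal_const_mul (h.1 a) (c a)
    have hsum : (∑ j ∈ s, fun ω => c j * ξ j ω) = fun ω => ∑ j ∈ s, c j * ξ j ω := by
      ext ω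
      simp
    have h2 := gaussianReal_add_gaussianReal_of_indepFun
      (hind.indepFun_finsetSum_of_notMem₀ hm ha).symm h1.map_eq (hsum ▸ ih.map_eq)
    rw [hsum] at h2
    refine ⟨by fun_prop, ?_⟩
    simp_rw [Finset.sum_insert ha]
    rw [Real.toNNReal_add (sq_nonneg _) (Finset.sum_nonneg fun _ _ => sq_nonneg _)]
    convert h2 using 2
    · rfl
    · simp
    · rw [mul_one, Real.toNNReal_of_nonneg (sq_nonneg _)]

/-- Multiplying the density by `exp (x² / 4)` leaves a Gaussian integral with value `√2`. -/
lemma lintegral_exp_sq_div_four_gaussianReal :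
    ∫⁻ x, ENNReal.ofReal (Real.exp (x ^ 2 / 4)) ∂(gaussianReal 0 1) ≤ 2 := by
  have hI : Integrable (fun x : ℝ => Real.exp (-(1 / 4) * x ^ 2)) :=
    integrable_exp_neg_mul_sq (by norm_num)
  rw [gaussianReal_of_var_ne_zero _ one_ne_zero,
    lintegral_withDensity_eq_lintegral_mul _ (measurable_gaussianPDF _ _) (by fun_prop)]
  have : ∀ x : ℝ, (gaussianPDF 0 1 * fun x => ENNReal.ofReal (Real.exp (x ^ 2 / 4))) x =
      ENNReal.ofReal ((√(2 * Real.pi))⁻¹ * Real.exp (-(1 / 4) * x ^ 2)) := by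
    intro x
    simp only [Pi.mul_apply, gaussianPDF, gaussianPDFReal]
    rw [← ENNReal.ofReal_mul (by positivity), mul_assoc, ← Real.exp_add]
    simp only [NNReal.coe_one, mul_one, sub_zero]
    congr 3
    ring
  simp_rw [this]
  rw [← ofReal_integral_eq_lintegral_ofReal (hI.const_mul _)
    (Eventually.of_forall fun x => by positivity), integral_const_mul, integral_gaussian]
  refine ENNReal.ofReal_le_of_le_toReal ?_
  rw [ENNReal.toReal_ofNat, ← Real.sqrt_inv, ← Real.sqrt_mul (by positivity)]
  rw [Real.sqrt_le_left (by norm_num)]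
  field_simp
  norm_num

lemma lintegral_exp_sq_div_four_le {v : ℝ≥0} (hv : v ≤ 1) {G : Ω → ℝ}
    (hG : HasLaw G (gaussianReal 0 v) Q) :
    ∫⁻ ω, ENNReal.ofReal (Real.exp (G ω ^ 2 / 4)) ∂Q ≤ 2 := by
  rw [hG.lintegral_comp (f := fun x => ENNReal.ofReal (Real.exp (x ^ 2 / 4))) (by fun_prop)]
  have : gaussianReal 0 v = (gaussianReal 0 1).map (fun x => √(v : ℝ) * x) := by
    rw [gaussianReal_map_const_mul]
    congr 1
    · simp
    · ext
      simp
  rw [this, lintegral_map (by fun_prop) (by fun_prop)]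
  refine (lintegral_mono fun x => ?_).trans lintegral_exp_sq_div_four_gaussianReal
  refine ENNReal.ofReal_le_ofReal (Real.exp_le_exp.2 (div_le_div_of_nonneg_right ?_ (by norm_num)))
  rw [mul_pow, Real.sq_sqrt v.coe_nonneg]
  exact mul_le_of_le_one_left (sq_nonneg _) (by exact_mod_cast hv)

/-- A union bound packed into one random variable: `A = ∑ w_i exp (G_i² / 4)` has mean at most `2 B`
and dominates each of its terms, so taking logarithms bounds every `G_i²`. With `Λ = log (1 + A)`,
the summand `1` makes `Λ` nonnegative. -/
lemma exists_forall_sq_le {ι : Type*} [Countable ι] (G : ι → Ω → ℝ)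
    (hGm : ∀ i, AEMeasurable (G i) Q) [IsProbabilityMeasure Q]
    (hG : ∀ i, ∫⁻ ω, ENNReal.ofReal (Real.exp (G i ω ^ 2 / 4)) ∂Q ≤ 2) (w : ι → ℝ)
    (hw : ∀ i, 0 < w i) {B : ℝ≥0} (hB : ∑' i, ENNReal.ofReal (w i) ≤ B) :
    ∃ Λ : Ω → ℝ, AEMeasurable Λ Q ∧ (∀ ω, 0 ≤ Λ ω) ∧
      ∫⁻ ω, ENNReal.ofReal (Real.exp (Λ ω)) ∂Q ≤ 1 + B * 2 ∧
      ∀ᵐ ω ∂Q, ∀ i, G i ω ^ 2 ≤ 4 * (Λ ω + Real.log (1 / w i)) := by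
  have hm : ∀ i, AEMeasurable (fun ω => ENNReal.ofReal (w i) *
      ENNReal.ofReal (Real.exp (G i ω ^ 2 / 4))) Q := fun i => by
    have := hGm i
    fun_prop
  set A : Ω → ℝ≥0∞ := fun ω => ∑' i, ENNReal.ofReal (w i) *
    ENNReal.ofReal (Real.exp (G i ω ^ 2 / 4)) with hA
  have hAm : AEMeasurable A Q := AEMeasurable.tsum hm
  have hAi : ∫⁻ ω, A ω ∂Q ≤ B * 2 := by
    rw [hA, lintegral_tsum hm]
    calc _ ≤ ∑' i, ENNReal.ofReal (w i) * 2 := by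
          refine ENNReal.tsum_le_tsum fun i => ?_
          rw [lintegral_const_mul' _ _ ENNReal.ofReal_ne_top]
          gcongr
          exact hG i
      _ ≤ _ := by
          rw [ENNReal.tsum_mul_right]
          gcongr
  have hfin : ∀ᵐ ω ∂Q, A ω < ∞ := ae_lt_top' hAm (ne_top_of_le_ne_top (by finiteness) hAi)
  -- On the null set where `A = ∞`, `toReal` gives `0`, hence `Λ = 0`.
  refine ⟨fun ω => Real.log (1 + (A ω).toReal), ?_, fun ω => ?_, ?_, ?_⟩
  · fun_prop
  · exact Real.log_nonneg (by simp)
  · calc _ ≤ ∫⁻ ω, 1 + A ω ∂Q := by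
          refine lintegral_mono fun ω => ?_
          rw [Real.exp_log (by positivity), ENNReal.ofReal_add zero_le_one ENNReal.toReal_nonneg,
            ENNReal.ofReal_one]
          gcongr
          exact ENNReal.ofReal_toReal_le
      _ ≤ _ := by
          rw [lintegral_add_left measurable_const]
          simp only [lintegral_const, measure_univ, mul_one]
          gcongr
  · filter_upwards [hfin] with ω hω i
    have h1 : ENNReal.ofReal (w i) * ENNReal.ofReal (Real.exp (G i ω ^ 2 / 4)) ≤ A ω :=
      ENNReal.le_tsum i
    rw [← ENNReal.ofReal_mul (hw i).le, ENNReal.ofReal_le_iff_le_toReal hω.ne] at h1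
    have h2 : Real.exp (G i ω ^ 2 / 4) ≤ (1 + (A ω).toReal) * (1 / w i) := by
      rw [mul_one_div, le_div_iff₀ (hw i)]
      linarith
    have h3 := (Real.le_log_iff_exp_le (by have := hw i; positivity)).2 h2
    rw [Real.log_mul (by positivity) (by have := hw i; positivity)] at h3
    linarith

end Gaussian

/-! ### Tails of Gaussian series in the path space -/

section Tails

/-- The `i`-th point of the grid of mesh `T / (m + 1) ^ 3` in `[0, T]`. -/
noncomputable def gridPoint {T : ℝ} (hT : 0 ≤ T) (m i : ℕ) : Set.Icc (0 : ℝ) T :=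
  Set.projIcc 0 T hT (i * T / ((m : ℝ) + 1) ^ 3)

lemma exists_gridPoint_near {T : ℝ} (hT : 0 < T) (m : ℕ) (t : Set.Icc (0 : ℝ) T) :
    ∃ i ≤ (m + 1) ^ 3,
      |(t : ℝ) - (gridPoint hT.le m i : Set.Icc (0 : ℝ) T)| ≤ T / ((m : ℝ) + 1) ^ 3 := by
  obtain ⟨t, ht0, htT⟩ := t
  set q : ℝ := ((m : ℝ) + 1) ^ 3 with hq
  have hq0 : 0 < q := by positivity
  have hx : 0 ≤ t * q / T := by positivity
  have hle := Nat.floor_le hx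
  have hlt := Nat.lt_floor_add_one (t * q / T)
  rw [le_div_iff₀ hT] at hle
  rw [div_lt_iff₀ hT] at hlt
  refine ⟨⌊t * q / T⌋₊, ?_, ?_⟩
  · refine Nat.floor_le_of_le ?_
    rw [div_le_iff₀ hT]
    push_cast
    rw [← hq, mul_comm]
    gcongr
  · have h1 : (⌊t * q / T⌋₊ : ℝ) * T / q ≤ t := by
      rw [div_le_iff₀ hq0]
      exact hle
    have hmem : (⌊t * q / T⌋₊ : ℝ) * T / q ∈ Set.Icc 0 T := ⟨by positivity, h1.trans htT⟩
    rw [gridPoint, Set.projIcc_of_mem _ hmem]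
    simp only
    rw [abs_of_nonneg (by linarith), sub_le_iff_le_add, ← add_div, le_div_iff₀ hq0]
    nlinarith

variable {T C : ℝ} {f : ℕ → PathSpace T}

/-- Moving to the nearest grid point costs `O(R / m)`: there are at most `m` terms with Lipschitz
constants `O(m)`, against a mesh of order `m⁻³`. This is below the bound `R / √m` assumed on the
grid. -/
lemma norm_sum_Ico_le_of_grid (hT : 0 < T) (hC : 0 ≤ C)
    (hf : ∀ (j : ℕ) (s t : Set.Icc (0 : ℝ) T), |f j s - f j t| ≤ C * (j + 1) * |(s : ℝ) - t|)
    {x : ℕ → ℝ} {R : ℝ} (hR : 0 ≤ R) {m n : ℕ} (hm : 1 ≤ m) (hn : n ≤ 2 * m)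
    (hx : ∀ j ∈ Finset.Ico m n, |x j| ≤ R)
    (hgrid : ∀ i ≤ (m + 1) ^ 3,
      |∑ j ∈ Finset.Ico m n, x j * f j (gridPoint hT.le m i)| ≤ C * R / √m) :
    ‖∑ j ∈ Finset.Ico m n, x j • f j‖ ≤ C * (1 + 2 * T) * R / √m := by
  have hm' : (1 : ℝ) ≤ m := by exact_mod_cast hm
  refine (ContinuousMap.norm_le _ (by positivity)).2 fun t => ?_
  obtain ⟨i, hi, hti⟩ := exists_gridPoint_near hT m t
  set u := gridPoint hT.le m i
  have h1 : (∑ j ∈ Finset.Ico m n, x j • f j) t =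
      ∑ j ∈ Finset.Ico m n, x j * f j u + ∑ j ∈ Finset.Ico m n, x j * (f j t - f j u) := by
    rw [← Finset.sum_add_distrib, ContinuousMap.sum_apply]
    refine Finset.sum_congr rfl fun j _ => ?_
    simp only [ContinuousMap.smul_apply, smul_eq_mul]
    ring
  have h2 : |∑ j ∈ Finset.Ico m n, x j * (f j t - f j u)| ≤
      m * (R * (C * (2 * (m + 1)) * (T / ((m : ℝ) + 1) ^ 3))) := by
    refine (Finset.abs_sum_le_sum_abs _ _).trans ?_
    have hterm : ∀ j ∈ Finset.Ico m n, |x j * (f j t - f j u)| ≤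
        R * (C * (2 * (m + 1)) * (T / ((m : ℝ) + 1) ^ 3)) := by
      intro j hj
      have hj2 : ((j + 1 : ℕ) : ℝ) ≤ ((2 * (m + 1) : ℕ) : ℝ) := by
        have := (Finset.mem_Ico.1 hj).2
        exact_mod_cast (by omega)
      push_cast at hj2
      rw [abs_mul]
      gcongr
      · exact hx j hj
      · exact (hf j t u).trans (by gcongr)
    refine (Finset.sum_le_sum hterm).trans ?_
    rw [Finset.sum_const, nsmul_eq_mul, Nat.card_Ico]
    gcongr
    omega
  have h3 : m * (R * (C * (2 * (m + 1)) * (T / ((m : ℝ) + 1) ^ 3))) ≤ C * (2 * T) * R / √m := by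
    have hs : √(m : ℝ) ≤ m + 1 := by
      rw [Real.sqrt_le_left (by positivity)]
      nlinarith
    have hs0 : 0 < √(m : ℝ) := by positivity
    rw [le_div_iff₀ hs0]
    calc _ ≤ (m + 1) * (R * (C * (2 * (m + 1)) * (T / ((m : ℝ) + 1) ^ 3))) * (m + 1) := by
          gcongr
          linarith
      _ = _ := by field_simp
  rw [h1, Real.norm_eq_abs]
  refine (abs_add_le _ _).trans ((add_le_add (hgrid i hi) (h2.trans h3)).trans (le_of_eq ?_))
  ring

/-- The normalized variables that control a Gaussian series: the coefficients `ξ_m`, and the values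
at grid points of the blocks of length at most `m` starting at `m`. -/
noncomputable def blockFamily {Ω : Type*} (hT : 0 ≤ T) (C : ℝ) (f : ℕ → PathSpace T) (ξ : ℕ → Ω → ℝ) :
    ℕ × ℕ × ℕ → Ω → ℝ
  | (m, _, 0) => ξ m
  | (m, d, i + 1) => fun ω => ∑ j ∈ Finset.Ico m (m + min d m),
      (√m / C * f j (gridPoint hT m i)) * ξ j ω

/-- Summable weights on the indices of `blockFamily`. -/
noncomputable def blockWeight (p : ℕ × ℕ × ℕ) : ℝ :=
  1 / ((p.1 : ℝ) + 1) ^ 2 * (1 / ((p.2.1 : ℝ) + 1) ^ 2 * (1 / ((p.2.2 : ℝ) + 1) ^ 2))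

lemma exists_tsum_blockWeight_le : ∃ B : ℝ≥0, ∑' p, ENNReal.ofReal (blockWeight p) ≤ B := by
  have hs : Summable fun n : ℕ => 1 / ((n : ℝ) + 1) ^ 2 := by
    have := (summable_nat_add_iff 1).2 (Real.summable_one_div_nat_pow.2 (by norm_num : 1 < 2))
    simpa using this
  have h0 : ∀ n : ℕ, 0 ≤ 1 / ((n : ℝ) + 1) ^ 2 := fun n => by positivity
  have h2 : Summable blockWeight :=
    hs.mul_of_nonneg (hs.mul_of_nonneg hs h0 h0) h0 fun p => by positivity
  refine ⟨(∑' p, blockWeight p).toNNReal, ?_⟩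
  rw [← ENNReal.ofReal_tsum_of_nonneg (fun p => by unfold blockWeight; positivity) h2]
  rfl

/-- The factor `√m / C` is chosen to make the variances at most `1`: a block has at most `m` terms,
and each squared coefficient is at most `m / (m + 1)²`. -/
lemma lintegral_exp_blockFamily_le {Ω : Type*} [MeasurableSpace Ω] {Q : Measure Ω} (hT : 0 ≤ T)
    (hC : 0 < C) (hf : ∀ j : ℕ, ‖f j‖ ≤ C / (j + 1)) {ξ : ℕ → Ω → ℝ} (hξ : IsStdNormalSeq ξ Q)
    (p : ℕ × ℕ × ℕ) :
    ∫⁻ ω, ENNReal.ofReal (Real.exp (blockFamily hT C f ξ p ω ^ 2 / 4)) ∂Q ≤ 2 := by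
  obtain ⟨m, d, _ | i⟩ := p
  · exact lintegral_exp_sq_div_four_le le_rfl (hξ.1 m)
  · refine lintegral_exp_sq_div_four_le ?_ (hξ.hasLaw_sum _ _)
    rw [Real.toNNReal_le_one]
    have hterm : ∀ j ∈ Finset.Ico m (m + min d m),
        (√m / C * f j (gridPoint hT m i)) ^ 2 ≤ m / ((m : ℝ) + 1) ^ 2 := by
      intro j hj
      have hmj : (m : ℝ) ≤ j := by exact_mod_cast (Finset.mem_Ico.1 hj).1
      have h1 : |f j (gridPoint hT m i)| ≤ C / (m + 1) :=
        ((f j).norm_coe_le_norm _).trans ((hf j).trans (by gcongr))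
      rw [mul_pow, div_pow, Real.sq_sqrt (Nat.cast_nonneg m), ← sq_abs (f j _)]
      calc _ ≤ (m : ℝ) / C ^ 2 * (C / (m + 1)) ^ 2 := by gcongr
        _ = _ := by field_simp
    refine (Finset.sum_le_sum hterm).trans ?_
    rw [Finset.sum_const, nsmul_eq_mul, Nat.card_Ico]
    have : ((m + min d m - m : ℕ) : ℝ) ≤ m := by exact_mod_cast (by omega)
    rw [← mul_div_assoc, div_le_one (by positivity)]
    nlinarith [Nat.cast_nonneg (α := ℝ) m]

lemma aemeasurable_blockFamily {Ω : Type*} [MeasurableSpace Ω] {Q : Measure Ω} (hT : 0 ≤ T)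
    {ξ : ℕ → Ω → ℝ} (hξ : IsStdNormalSeq ξ Q) (p : ℕ × ℕ × ℕ) :
    AEMeasurable (blockFamily hT C f ξ p) Q := by
  obtain ⟨m, d, _ | i⟩ := p
  · exact hξ.aemeasurable m
  · exact (hξ.hasLaw_sum _ _).aemeasurable

lemma log_one_div_blockWeight (m d i : ℕ) : Real.log (1 / blockWeight (m, d, i)) =
    2 * Real.log (m + 1) + 2 * Real.log (d + 1) + 2 * Real.log (i + 1) := by
  have : 1 / blockWeight (m, d, i) =
      ((m : ℝ) + 1) ^ 2 * (((d : ℝ) + 1) ^ 2 * ((i : ℝ) + 1) ^ 2) := by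
    simp only [blockWeight]
    field_simp
  rw [this, Real.log_mul (by positivity) (by positivity),
    Real.log_mul (by positivity) (by positivity), Real.log_pow, Real.log_pow, Real.log_pow]
  push_cast
  ring

/-- The bound for blocks of length at most `m`. -/
lemma norm_sum_Ico_le_of_le_two_mul {Ω : Type*} (hT : 0 < T) (hC : 0 < C)
    (hf : ∀ (j : ℕ) (s t : Set.Icc (0 : ℝ) T), |f j s - f j t| ≤ C * (j + 1) * |(s : ℝ) - t|)
    {ξ : ℕ → Ω → ℝ} {ω : Ω} {l : ℝ} (hl : 0 ≤ l)
    (h : ∀ p, blockFamily hT.le C f ξ p ω ^ 2 ≤ 4 * (l + Real.log (1 / blockWeight p)))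
    {m n : ℕ} (hm : 1 ≤ m) (hmn : m ≤ n) (hn : n ≤ 2 * m) :
    ‖∑ j ∈ Finset.Ico m n, ξ j ω • f j‖ ≤
      C * (1 + 2 * T) * 7 * √((l + Real.log (m + 1)) / m) := by
  have hm' : (1 : ℝ) ≤ m := by exact_mod_cast hm
  have hlog : 0 ≤ Real.log ((m : ℝ) + 1) := Real.log_nonneg (by linarith)
  -- In units of `log (m + 1)`, the weights cost at most `2` for the start, `2` for the length and
  -- `2 · 4` for the grid index, which is at most `(m + 1) ^ 3 + 1`. The total is `12`, and `4 · 12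
  -- ≤ 7²`.
  set R := 7 * √(l + Real.log (m + 1)) with hR
  have hbound : ∀ p, Real.log (1 / blockWeight p) ≤ 12 * Real.log (m + 1) →
      |blockFamily hT.le C f ξ p ω| ≤ R := by
    intro p hp
    refine abs_le_of_sq_le_sq ?_ (by positivity)
    rw [hR, mul_pow, Real.sq_sqrt (by positivity)]
    linarith [h p]
  have key := norm_sum_Ico_le_of_grid hT hC.le hf (x := fun j => ξ j ω) (R := R) (by positivity)
    hm hn ?_ ?_
  · refine key.trans (le_of_eq ?_)
    rw [hR, Real.sqrt_div (by positivity)]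
    ring
  · intro j hj
    refine hbound (j, 0, 0) ?_
    rw [log_one_div_blockWeight]
    have h1 : Real.log ((j : ℝ) + 1) ≤ Real.log (((m : ℝ) + 1) ^ 2) := by
      refine Real.log_le_log (by positivity) ?_
      have : (j : ℝ) ≤ 2 * m := by
        have := (Finset.mem_Ico.1 hj).2
        exact_mod_cast (by omega)
      nlinarith
    rw [Real.log_pow] at h1
    push_cast at h1 ⊢
    simp only [zero_add, Real.log_one]
    linarith
  · intro i hi
    have h2 := hbound (m, n - m, i + 1) ?_
    · have h3 : blockFamily hT.le C f ξ (m, n - m, i + 1) ω =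
          √m / C * ∑ j ∈ Finset.Ico m n, ξ j ω * f j (gridPoint hT.le m i) := by
        have : m + min (n - m) m = n := by omega
        simp only [blockFamily]
        rw [this, Finset.mul_sum]
        exact Finset.sum_congr rfl fun j _ => by ring
      have hs : 0 < √(m : ℝ) := by positivity
      rw [h3, abs_mul, abs_of_pos (by positivity), div_mul_eq_mul_div, div_le_iff₀ hC] at h2
      rw [le_div_iff₀ hs]
      linarith
    · rw [log_one_div_blockWeight]
      have h1 : Real.log (((n - m : ℕ) : ℝ) + 1) ≤ Real.log ((m : ℝ) + 1) := by
        refine Real.log_le_log (by positivity) ?_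
        have : ((n - m : ℕ) : ℝ) ≤ m := by exact_mod_cast (by omega)
        linarith
      have h2 : Real.log (((i + 1 : ℕ) : ℝ) + 1) ≤ Real.log (((m : ℝ) + 1) ^ 4) := by
        refine Real.log_le_log (by positivity) ?_
        have : (i : ℝ) ≤ ((m : ℝ) + 1) ^ 3 := by exact_mod_cast hi
        push_cast
        nlinarith [pow_pos (by linarith : (0 : ℝ) < m + 1) 3, sq_nonneg (m : ℝ)]
      rw [Real.log_pow] at h2
      push_cast at h2 ⊢
      linarith

/-- For `m ≥ 3`, `log 2 ≤ log (m + 1) / 2`, so doubling `m` multiplies the quotient by at most `3/4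
≤ (7/8)²`. This makes the dyadic sum geometric. -/
lemma sqrt_log_two_mul_le {l : ℝ} (hl : 0 ≤ l) {m : ℕ} (hm : 3 ≤ m) :
    √((l + Real.log ((2 * m : ℕ) + 1)) / (2 * m : ℕ)) ≤
      7 / 8 * √((l + Real.log (m + 1)) / m) := by
  have hm' : (3 : ℝ) ≤ m := by exact_mod_cast hm
  have h1 : Real.log 4 ≤ Real.log ((m : ℝ) + 1) := Real.log_le_log (by norm_num) (by linarith)
  have h4 : Real.log 4 = 2 * Real.log 2 := by
    rw [show (4 : ℝ) = 2 ^ 2 by norm_num, Real.log_pow]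
    norm_num
  have h2 : Real.log ((2 * m : ℕ) + 1) ≤ Real.log 2 + Real.log ((m : ℝ) + 1) := by
    rw [← Real.log_mul (by norm_num) (by positivity)]
    refine Real.log_le_log (by positivity) ?_
    push_cast
    linarith
  have h0 : 0 ≤ Real.log ((m : ℝ) + 1) := Real.log_nonneg (by linarith)
  rw [show (7 / 8 : ℝ) = √((7 / 8) ^ 2) by rw [Real.sqrt_sq (by norm_num)],
    ← Real.sqrt_mul (by positivity)]
  refine Real.sqrt_le_sqrt ?_
  push_cast at h2 ⊢
  rw [← mul_div_assoc, div_le_div_iff₀ (by positivity) (by positivity)]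
  have h3 : l + Real.log (2 * (m : ℝ) + 1) ≤ 3 / 2 * (l + Real.log ((m : ℝ) + 1)) := by linarith
  have h5 : 0 ≤ l + Real.log ((m : ℝ) + 1) := by positivity
  nlinarith

/-- Peel off the block from `m` to `2m` and recurse. The factor `8 = 1 / (1 - 7/8)` is the sum of
the geometric series. -/
lemma norm_sum_Ico_le {Ω : Type*} (hT : 0 < T) (hC : 0 < C)
    (hf : ∀ (j : ℕ) (s t : Set.Icc (0 : ℝ) T), |f j s - f j t| ≤ C * (j + 1) * |(s : ℝ) - t|)
    {ξ : ℕ → Ω → ℝ} {ω : Ω} {l : ℝ} (hl : 0 ≤ l)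
    (h : ∀ p, blockFamily hT.le C f ξ p ω ^ 2 ≤ 4 * (l + Real.log (1 / blockWeight p)))
    {m n : ℕ} (hm : 3 ≤ m) (hmn : m ≤ n) :
    ‖∑ j ∈ Finset.Ico m n, ξ j ω • f j‖ ≤
      8 * (C * (1 + 2 * T) * 7) * √((l + Real.log (m + 1)) / m) := by
  set K := C * (1 + 2 * T) * 7 with hK
  have hK0 : 0 ≤ K := by positivity
  induction hk : n - m using Nat.strong_induction_on generalizing m with
  | _ k ih =>
    have hs := Real.sqrt_nonneg ((l + Real.log (m + 1)) / m)
    rcases le_total n (2 * m) with hn | hn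
    · refine (norm_sum_Ico_le_of_le_two_mul hT hC hf hl h (by omega) hmn hn).trans ?_
      nlinarith [mul_nonneg hK0 hs]
    · rw [← Finset.sum_Ico_consecutive _ (by omega : m ≤ 2 * m) hn]
      refine (norm_add_le _ _).trans ?_
      have h1 := norm_sum_Ico_le_of_le_two_mul hT hC hf hl h (by omega) (by omega : m ≤ 2 * m)
        le_rfl
      have h2 := ih (n - 2 * m) (by omega) (by omega) hn rfl
      have h3 := mul_le_mul_of_nonneg_left (sqrt_log_two_mul_le hl hm) (by positivity : 0 ≤ 8 * K)
      linarith

/-- Almost sure control of all tails of a Gaussian series in the path space by one random variable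
with an exponential moment. -/
theorem exists_forall_norm_sum_Ico_le (hT : 0 < T) (hC : 0 < C)
    (hf : ∀ j : ℕ, ‖f j‖ ≤ C / (j + 1))
    (hf' : ∀ (j : ℕ) (s t : Set.Icc (0 : ℝ) T), |f j s - f j t| ≤ C * (j + 1) * |(s : ℝ) - t|) :
    ∃ (K : ℝ) (B : ℝ≥0), 0 ≤ K ∧ ∀ {Ω : Type*} [MeasurableSpace Ω] (Q : Measure Ω)
      (ξ : ℕ → Ω → ℝ), IsStdNormalSeq ξ Q →
      ∃ Λ : Ω → ℝ, AEMeasurable Λ Q ∧ (∀ ω, 0 ≤ Λ ω) ∧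
        ∫⁻ ω, ENNReal.ofReal (Real.exp (Λ ω)) ∂Q ≤ B ∧
        ∀ᵐ ω ∂Q, ∀ m n, 3 ≤ m → m ≤ n →
          ‖∑ j ∈ Finset.Ico m n, ξ j ω • f j‖ ≤ K * √((Λ ω + Real.log (m + 1)) / m) := by
  obtain ⟨B, hB⟩ := exists_tsum_blockWeight_le
  refine ⟨8 * (C * (1 + 2 * T) * 7), 1 + B * 2, by positivity, fun Q ξ hξ => ?_⟩
  have := hξ.isProbabilityMeasure
  obtain ⟨Λ, h1, h2, h3, h4⟩ := exists_forall_sq_le (blockFamily hT.le C f ξ)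
    (aemeasurable_blockFamily hT.le hξ) (lintegral_exp_blockFamily_le hT.le hC hf hξ) blockWeight
    (fun p => by unfold blockWeight; positivity) hB
  refine ⟨Λ, h1, h2, by exact_mod_cast h3, ?_⟩
  filter_upwards [h4] with ω hω m n hm hmn
  exact norm_sum_Ico_le hT hC hf' (h2 ω) hω hm hmn

end Tails

/-! ### Convergence of the series and moments of its tails -/

section Convergence

lemma exists_one_add_rpow_le_mul_exp (r : ℝ) :
    ∃ c : ℝ, 0 < c ∧ ∀ y : ℝ, 0 ≤ y → (1 + y) ^ r ≤ c * Real.exp y := by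
  obtain ⟨k, hk⟩ := exists_nat_ge r
  refine ⟨k.factorial * Real.exp 1, by positivity, fun y hy => ?_⟩
  calc (1 + y) ^ r ≤ (1 + y) ^ (k : ℝ) := Real.rpow_le_rpow_of_exponent_le (by linarith) hk
    _ = (1 + y) ^ k := Real.rpow_natCast _ _
    _ ≤ k.factorial * Real.exp (1 + y) := by
      have := Real.pow_div_factorial_le_exp (1 + y) (by linarith) k
      rwa [div_le_iff₀' (by positivity)] at this
    _ = _ := by rw [Real.exp_add, mul_assoc]

lemma tendsto_sqrt_log_div (l : ℝ) :
    Tendsto (fun n : ℕ => √((l + Real.log (n + 1)) / n)) atTop (𝓝 0) := by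
  have h1 : Tendsto (fun x : ℝ => (l + Real.log (x + 1)) / x) atTop (𝓝 0) := by
    have h2 : Tendsto (fun x : ℝ => l / x) atTop (𝓝 0) := tendsto_const_nhds.div_atTop tendsto_id
    have h3 : Tendsto (fun x : ℝ => Real.log x / x) atTop (𝓝 0) := by
      simpa using Real.isLittleO_log_id_atTop.tendsto_div_nhds_zero
    have h4 : Tendsto (fun x : ℝ => Real.log (x + 1) / (x + 1) * ((x + 1) / x)) atTop (𝓝 (0 * 1)) := by
      refine (h3.comp (tendsto_atTop_add_const_right _ 1 tendsto_id)).mul ?_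
      have h5 : Tendsto (fun x : ℝ => 1 + 1 / x) atTop (𝓝 (1 + 0)) :=
        tendsto_const_nhds.add (tendsto_const_nhds.div_atTop tendsto_id)
      rw [add_zero] at h5
      refine h5.congr' ?_
      filter_upwards [eventually_gt_atTop 0] with x hx
      field_simp
    rw [zero_mul] at h4
    have h6 := h2.add h4
    rw [add_zero] at h6
    refine h6.congr' ?_
    filter_upwards [eventually_gt_atTop 0] with x hx
    field_simp
  have h7 := (h1.comp tendsto_natCast_atTop_atTop).sqrt
  simpa using h7

variable {Ω E : Type*} [MeasurableSpace Ω] {Q : Measure Ω} [NormedAddCommGroup E] [NormedSpace ℝ E]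
  {f : ℕ → E} {ξ : ℕ → Ω → ℝ} {K : ℝ} {Λ : Ω → ℝ}

lemma exists_tendsto_of_norm_sum_Ico_le [CompleteSpace E] {x : ℕ → ℝ} {l : ℝ}
    (h : ∀ m n, 3 ≤ m → m ≤ n →
      ‖∑ j ∈ Finset.Ico m n, x j • f j‖ ≤ K * √((l + Real.log (m + 1)) / m)) :
    ∃ s, Tendsto (fun n => ∑ j ∈ Finset.range n, x j • f j) atTop (𝓝 s) := by
  have hc : CauchySeq fun n => ∑ j ∈ Finset.range (n + 3), x j • f j := by
    refine cauchySeq_of_le_tendsto_0'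
      (fun n => K * √((l + Real.log ((n + 3 : ℕ) + 1)) / (n + 3 : ℕ))) (fun n m hnm => ?_) ?_
    · rw [dist_comm, dist_eq_norm, ← Finset.sum_Ico_eq_sub _ (by omega)]
      exact h _ _ (by omega) (by omega)
    · have := ((tendsto_add_atTop_iff_nat 3).2 (tendsto_sqrt_log_div l)).const_mul K
      rwa [mul_zero] at this
  obtain ⟨s, hs⟩ := cauchySeq_tendsto_of_complete hc
  exact ⟨s, (tendsto_add_atTop_iff_nat 3).1 hs⟩

lemma exists_sumsTo [CompleteSpace E]
    (h : ∀ᵐ ω ∂Q, ∀ m n, 3 ≤ m → m ≤ n →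
      ‖∑ j ∈ Finset.Ico m n, ξ j ω • f j‖ ≤ K * √((Λ ω + Real.log (m + 1)) / m)) :
    ∃ S, SumsTo ξ Q f S := by
  classical
  have h1 : ∀ᵐ ω ∂Q, ∃ s, Tendsto (fun n => ∑ j ∈ Finset.range n, ξ j ω • f j) atTop (𝓝 s) := by
    filter_upwards [h] with ω hω
    exact exists_tendsto_of_norm_sum_Ico_le hω
  refine ⟨fun ω => if hω : ∃ s, Tendsto (fun n => ∑ j ∈ Finset.range n, ξ j ω • f j) atTop (𝓝 s)
    then hω.choose else 0, ?_⟩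
  filter_upwards [h1] with ω hω
  rw [dif_pos hω]
  exact hω.choose_spec

lemma SumsTo.norm_sub_le {S : Ω → E} (hS : SumsTo ξ Q f S)
    (h : ∀ᵐ ω ∂Q, ∀ m n, 3 ≤ m → m ≤ n →
      ‖∑ j ∈ Finset.Ico m n, ξ j ω • f j‖ ≤ K * √((Λ ω + Real.log (m + 1)) / m)) :
    ∀ᵐ ω ∂Q, ∀ m, 3 ≤ m → ‖S ω - ∑ j ∈ Finset.range m, ξ j ω • f j‖ ≤
      K * √((Λ ω + Real.log (m + 1)) / m) := by
  filter_upwards [hS, h] with ω h1 h2 m hm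
  refine le_of_tendsto (h1.sub_const _).norm ?_
  filter_upwards [eventually_ge_atTop m] with n hn
  rw [← Finset.sum_Ico_eq_sub _ hn]
  exact h2 m n hm hn

/-- As `log (m + 1) ≥ 1`, the random part factors out as `1 + Λ`, whose `r`-th power is dominated by
a multiple of `exp Λ`. -/
lemma lintegral_enorm_rpow_le {F : Type*} [NormedAddCommGroup F] {r c : ℝ} (hr : 0 < r)
    (hK : 0 ≤ K) (hΛ : ∀ ω, 0 ≤ Λ ω)
    {B : ℝ≥0} (hB : ∫⁻ ω, ENNReal.ofReal (Real.exp (Λ ω)) ∂Q ≤ B)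
    (hc : 0 < c) (hc' : ∀ y : ℝ, 0 ≤ y → (1 + y) ^ r ≤ c * Real.exp y)
    {U : Ω → F} {m : ℕ} (hm : 3 ≤ m)
    (hU : ∀ᵐ ω ∂Q, ‖U ω‖ ≤ K * √((Λ ω + Real.log (m + 1)) / m)) :
    ∫⁻ ω, ‖U ω‖ₑ ^ r ∂Q ≤
      ENNReal.ofReal (c * K ^ r * √(Real.log (m + 1) / m) ^ r) * B := by
  have hm' : (3 : ℝ) ≤ m := by exact_mod_cast hm
  have hlog : 1 ≤ Real.log ((m : ℝ) + 1) := by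
    rw [Real.le_log_iff_exp_le (by positivity)]
    linarith [Real.exp_one_lt_d9]
  have hpt : ∀ᵐ ω ∂Q, ‖U ω‖ₑ ^ r ≤ ENNReal.ofReal (c * K ^ r * √(Real.log (m + 1) / m) ^ r) *
      ENNReal.ofReal (Real.exp (Λ ω)) := by
    filter_upwards [hU] with ω hω
    have h0 := hΛ ω
    have h1 : √((Λ ω + Real.log (m + 1)) / m) ≤ √(Real.log (m + 1) / m) * (1 + Λ ω) := by
      rw [Real.sqrt_le_left (by positivity), mul_pow, Real.sq_sqrt (by positivity),
        div_mul_eq_mul_div]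
      gcongr
      nlinarith [mul_nonneg h0 (by linarith : 0 ≤ Real.log ((m : ℝ) + 1)),
        mul_nonneg (mul_nonneg h0 h0) (by linarith : 0 ≤ Real.log ((m : ℝ) + 1))]
    have h2 : ‖U ω‖ ≤ K * (√(Real.log (m + 1) / m) * (1 + Λ ω)) :=
      hω.trans (by gcongr)
    rw [← ofReal_norm, ENNReal.ofReal_rpow_of_nonneg (norm_nonneg _) hr.le,
      ← ENNReal.ofReal_mul (by positivity)]
    refine ENNReal.ofReal_le_ofReal ?_
    calc ‖U ω‖ ^ r ≤ (K * (√(Real.log (m + 1) / m) * (1 + Λ ω))) ^ r := by gcongr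
      _ = K ^ r * (√(Real.log (m + 1) / m) ^ r * (1 + Λ ω) ^ r) := by
        rw [Real.mul_rpow hK (by positivity), Real.mul_rpow (by positivity) (by positivity)]
      _ ≤ K ^ r * (√(Real.log (m + 1) / m) ^ r * (c * Real.exp (Λ ω))) := by
        gcongr
        exact hc' _ h0
      _ = _ := by ring
  refine (lintegral_mono_ae hpt).trans ?_
  rw [lintegral_const_mul' _ _ ENNReal.ofReal_ne_top]
  gcongr

end Convergence

/-! ### Optimal quantizers -/

section OptimalQuantization

variable {Ω : Type*} [MeasurableSpace Ω] {Q : Measure Ω}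

lemma nearestPt_mem (e : ℕ → ℝ) (N : ℕ) (x : ℝ) :
    ∃ k ≤ N, SimpleFunc.nearestPt e N x = e k :=
  ⟨SimpleFunc.nearestPtInd e N x, SimpleFunc.nearestPtInd_le e N x, rfl⟩

lemma isQuantization_comp_of_forall_mem {q : ℝ → ℝ} (hq : Measurable q) {s : Finset ℝ} {M : ℕ}
    (hs : s.card ≤ M) (hqs : ∀ x, q x ∈ s) {Z : Ω → ℝ} (hZ : Measurable Z) :
    IsQuantization (fun ω => q (Z ω)) M := by
  refine ⟨hq.comp hZ, ?_⟩
  calc (Set.range fun ω => q (Z ω)).encard ≤ (s : Set ℝ).encard :=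
        Set.encard_le_encard (by rintro _ ⟨ω, rfl⟩; exact hqs _)
    _ ≤ M := by
      rw [Set.encard_coe_eq_coe_finsetCard]
      exact_mod_cast hs

lemma isQuantization_nearestPt (e : ℕ → ℝ) (N : ℕ) {Z : Ω → ℝ} (hZ : Measurable Z) :
    IsQuantization (fun ω => SimpleFunc.nearestPt e N (Z ω)) (N + 1) := by
  refine isQuantization_comp_of_forall_mem (SimpleFunc.measurable _)
    (s := (Finset.range (N + 1)).image e)
    (Finset.card_image_le.trans (Finset.card_range _).le) (fun x => ?_) hZ
  obtain ⟨k, hk, h⟩ := nearestPt_mem e N x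
  rw [h]
  exact Finset.mem_image_of_mem _ (Finset.mem_range.2 (by omega))

/-- The error of quantizing a random variable with law `μ` by `e 0, …, e N`. -/
noncomputable def nearestError (μ : Measure ℝ) (r : ℝ) (N : ℕ) (e : ℕ → ℝ) : ℝ≥0∞ :=
  ∫⁻ x, edist (SimpleFunc.nearestPt e N x) x ^ r ∂μ

/-- Projecting `Z` to the nearest value of `Y` is pointwise at least as good as `Y`. This reduces
optimality to a minimization over codebooks. -/
lemma exists_nearestError_le {Y Z : Ω → ℝ} {N : ℕ} (hY : IsQuantization Y (N + 1)) {r : ℝ}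
    (hr : 0 < r) [Nonempty Ω] {μ : Measure ℝ} (hZ : HasLaw Z μ Q) :
    ∃ e : ℕ → ℝ, nearestError μ r N e ≤ ∫⁻ ω, ‖Z ω - Y ω‖ₑ ^ r ∂Q := by
  have hfin : (Set.range Y).Finite := Set.finite_of_encard_le_coe hY.2
  have hcard : hfin.toFinset.card ≤ N + 1 := by
    have := hY.2
    rw [hfin.encard_eq_coe_toFinset_card] at this
    exact_mod_cast this
  obtain ⟨e, he⟩ : ∃ e : ℕ → ℝ, ∀ y ∈ Set.range Y, ∃ k ≤ N, e k = y := by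
    let l := hfin.toFinset.toList
    -- Padding a short list with `0` is harmless: extra code points only reduce the distance.
    refine ⟨fun k => l.getD k 0, fun y hy => ?_⟩
    have hyl : y ∈ l := by simpa [l] using hy
    obtain ⟨k, hk, hky⟩ := List.getElem_of_mem hyl
    have hlen : l.length ≤ N + 1 := by simpa [l] using hcard
    exact ⟨k, by omega, by simp [hk, hky]⟩
  refine ⟨e, ?_⟩
  rw [nearestError, ← hZ.lintegral_comp (f := fun x => edist (SimpleFunc.nearestPt e N x) x ^ r)
    (by fun_prop)]
  refine lintegral_mono fun ω => ?_
  obtain ⟨k, hk, hky⟩ := he (Y ω) ⟨ω, rfl⟩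
  refine ENNReal.rpow_le_rpow ?_ hr.le
  refine (SimpleFunc.edist_nearestPt_le e (Z ω) hk).trans ?_
  rw [hky, edist_comm, edist_eq_enorm_sub]

/-- Along a subsequence, a sequence of real numbers converges or escapes from every point. -/
lemma exists_strictMono_tendsto_or_escape (N : ℕ) (x : ℕ → ℕ → ℝ) :
    ∃ (φ : ℕ → ℕ), StrictMono φ ∧ ∀ k ≤ N, (∃ a, Tendsto (fun n => x (φ n) k) atTop (𝓝 a)) ∨
      ∀ z : ℝ, Tendsto (fun n => edist (x (φ n) k) z) atTop (𝓝 ∞) := by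
  -- Compactness of a finite power of `EReal`; an infinite limit means escape.
  obtain ⟨y, φ, hφ, hy⟩ := CompactSpace.tendsto_subseq
    (fun n (k : Fin (N + 1)) => ((x n k : ℝ) : EReal))
  refine ⟨φ, hφ, fun k hk => ?_⟩
  have hk' := (tendsto_pi_nhds.1 hy) ⟨k, by omega⟩
  simp only [Function.comp_def] at hk'
  have hesc : Tendsto (fun n => |x (φ n) k|) atTop atTop → ∀ z : ℝ,
      Tendsto (fun n => edist (x (φ n) k) z) atTop (𝓝 ∞) := by
    intro h z
    have h2 : Tendsto (fun n => dist (x (φ n) k) z) atTop atTop := by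
      refine tendsto_atTop_mono (fun n => ?_) (tendsto_atTop_add_const_right _ (-|z|) h)
      rw [Real.dist_eq]
      linarith [abs_sub_abs_le_abs_sub (x (φ n) k) z]
    simp_rw [edist_dist]
    exact ENNReal.tendsto_ofReal_atTop.comp h2
  induction h : y ⟨k, by omega⟩ using EReal.rec with
  | bot =>
    rw [h, EReal.tendsto_coe_nhds_bot_iff] at hk'
    exact Or.inr (hesc (tendsto_abs_atBot_atTop.comp hk'))
  | top =>
    rw [h, EReal.tendsto_coe_nhds_top_iff] at hk'
    exact Or.inr (hesc (tendsto_abs_atTop_atTop.comp hk'))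
  | coe a =>
    rw [h, EReal.tendsto_coe] at hk'
    exact Or.inl ⟨a, hk'⟩

/-- The direct method: extract a subsequence of a minimizing sequence along which each code point
converges or escapes, and apply Fatou's lemma. If all points escaped, the infimum would be infinite,
but the codebook `0` has finite error. -/
lemma exists_forall_nearestError_le {μ : Measure ℝ} [NeZero μ] {r : ℝ} (hr : 0 < r) (N : ℕ)
    (h0 : ∫⁻ x, ‖x‖ₑ ^ r ∂μ < ∞) :
    ∃ e₀, ∀ e, nearestError μ r N e₀ ≤ nearestError μ r N e := by
  obtain ⟨u, -, hu, hu'⟩ := exists_seq_tendsto_sInf (Set.range_nonempty (nearestError μ r N))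
    (OrderBot.bddBelow _)
  choose x hx using hu'
  obtain ⟨φ, hφ, hlim⟩ := exists_strictMono_tendsto_or_escape N x
  have hu2 := hu.comp hφ.tendsto_atTop
  have hinf : sInf (Set.range (nearestError μ r N)) < ∞ := by
    refine (sInf_le (Set.mem_range_self fun _ => 0)).trans_lt
      (lt_of_le_of_lt (lintegral_mono fun z => ?_) h0)
    obtain ⟨k, -, hk⟩ := nearestPt_mem (fun _ => (0 : ℝ)) N z
    simp only [hk]
    rw [edist_comm, edist_zero_right]
  -- Fatou's lemma, for any `d` lying asymptotically below the distance to each code point.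
  have key : ∀ d : ℝ → ℝ≥0∞, (∀ z, ∀ c < d z, ∀ k ≤ N, ∀ᶠ n in atTop, c < edist (x (φ n) k) z) →
      ∫⁻ z, d z ^ r ∂μ ≤ sInf (Set.range (nearestError μ r N)) := by
    intro d hd
    have h1 : ∀ z, d z ^ r ≤
        liminf (fun n => edist (SimpleFunc.nearestPt (x (φ n)) N z) z ^ r) atTop := by
      intro z
      refine le_of_forall_lt fun c hc => ?_
      obtain ⟨c', hc', hc'd⟩ := exists_between hc
      have h2 : c' ^ (1 / r) < d z := by
        rw [← ENNReal.rpow_lt_rpow_iff hr, ← ENNReal.rpow_mul, one_div_mul_cancel hr.ne',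
          ENNReal.rpow_one]
        exact hc'd
      have h3 : ∀ᶠ n in atTop, ∀ k ∈ Set.Iic N, c' ^ (1 / r) < edist (x (φ n) k) z :=
        (eventually_all_finite (Set.finite_Iic N)).2 fun k hk => hd z _ h2 k hk
      refine hc'.trans_le (le_liminf_of_le (by isBoundedDefault) ?_)
      filter_upwards [h3] with n hn
      obtain ⟨k, hk, hkn⟩ := nearestPt_mem (x (φ n)) N z
      rw [hkn, ← ENNReal.rpow_le_rpow_iff (one_div_pos.2 hr), ← ENNReal.rpow_mul,
        mul_one_div_cancel hr.ne', ENNReal.rpow_one]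
      exact (hn k hk).le
    calc _ ≤ ∫⁻ z, liminf (fun n => edist (SimpleFunc.nearestPt (x (φ n)) N z) z ^ r) atTop ∂μ :=
          lintegral_mono h1
      _ ≤ liminf (fun n => ∫⁻ z, edist (SimpleFunc.nearestPt (x (φ n)) N z) z ^ r ∂μ) atTop :=
          lintegral_liminf_le fun n => by fun_prop
      _ = _ := by
          refine Tendsto.liminf_eq ?_
          convert hu2 using 2 with n
          exact hx (φ n)
  by_cases hF : ∃ k₀ ≤ N, ∃ a, Tendsto (fun n => x (φ n) k₀) atTop (𝓝 a)
  · obtain ⟨k₀, hk₀, a₀, ha₀⟩ := hF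
    -- Escaping indices receive the finite value `a₀`. An additional code point can only lower the
    -- distance, so the condition in `key` survives.
    have hlim' : ∀ k, ∃ a, k ≤ N → Tendsto (fun n => x (φ n) k) atTop (𝓝 a) ∨
        a = a₀ ∧ ∀ z : ℝ, Tendsto (fun n => edist (x (φ n) k) z) atTop (𝓝 ∞) := by
      intro k
      by_cases hk : k ≤ N
      · obtain ⟨a, ha⟩ | h := hlim k hk
        · exact ⟨a, fun _ => Or.inl ha⟩
        · exact ⟨a₀, fun _ => Or.inr ⟨rfl, h⟩⟩
      · exact ⟨0, fun h => absurd h hk⟩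
    choose e he using hlim'
    have hek₀ : e k₀ = a₀ := by
      obtain h | h := he k₀ hk₀
      · exact tendsto_nhds_unique h ha₀
      · exact h.1
    refine ⟨e, fun e' => ?_⟩
    refine (key (fun z => edist (SimpleFunc.nearestPt e N z) z) fun z c hc k hk => ?_).trans
      (sInf_le ⟨e', rfl⟩)
    obtain h | h := he k hk
    · have h1 : Tendsto (fun n => edist (x (φ n) k) z) atTop (𝓝 (edist (e k) z)) :=
        h.edist tendsto_const_nhds
      exact h1.eventually_const_lt (hc.trans_le (SimpleFunc.edist_nearestPt_le e z hk))
    · exact (h.2 z).eventually_const_lt (hc.trans_le le_top)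
  · exfalso
    push Not at hF
    have h1 := key (fun _ => ∞) fun z c hc k hk => by
      obtain ⟨a, ha⟩ | h := hlim k hk
      · exact absurd ha (hF k hk a)
      · exact (h z).eventually_const_lt hc
    rw [ENNReal.top_rpow_of_pos hr, lintegral_const, ENNReal.top_mul] at h1
    · exact absurd hinf (not_lt.2 h1)
    · simpa using NeZero.ne μ

lemma exists_isOptimalQuantization [IsProbabilityMeasure Q] {Z : Ω → ℝ} {μ : Measure ℝ}
    (hZ : HasLaw Z μ Q) {r : ℝ} (hr : 0 < r) (h0 : ∫⁻ x, ‖x‖ₑ ^ r ∂μ < ∞) {M : ℕ} (hM : 1 ≤ M) :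
    ∃ Y, IsOptimalQuantization Z Y Q M r := by
  obtain ⟨N, rfl⟩ : ∃ N, M = N + 1 := ⟨M - 1, by omega⟩
  have : IsProbabilityMeasure μ := hZ.map_eq ▸ Measure.isProbabilityMeasure_map hZ.aemeasurable
  have : Nonempty Ω := nonempty_of_isProbabilityMeasure Q
  obtain ⟨e, he⟩ := exists_forall_nearestError_le hr N h0
  -- Quantizations are required to be measurable, whereas `Z` is only a.e. measurable; hence the
  -- measurable version.
  refine ⟨fun ω => SimpleFunc.nearestPt e N (hZ.aemeasurable.mk Z ω),
    isQuantization_nearestPt e N hZ.aemeasurable.measurable_mk, le_antisymm ?_ ?_⟩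
  · refine le_iInf₂ fun Y hY => ?_
    obtain ⟨e', he'⟩ := exists_nearestError_le hY hr hZ
    refine ENNReal.rpow_le_rpow (le_trans (le_of_eq ?_) ((he e').trans he')) (by positivity)
    rw [nearestError, ← hZ.lintegral_comp
      (f := fun x => edist (SimpleFunc.nearestPt e N x) x ^ r) (by fun_prop)]
    refine lintegral_congr_ae ?_
    filter_upwards [hZ.aemeasurable.ae_eq_mk] with ω hω
    rw [← hω, edist_comm, edist_eq_enorm_sub]
  · exact iInf_le_of_le _ (iInf_le _ (isQuantization_nearestPt e N hZ.aemeasurable.measurable_mk))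

end OptimalQuantization

/-! ### The error of product quantizations -/

section GridQuantizer

variable {Ω : Type*} [MeasurableSpace Ω] {Q : Measure Ω}

/-- The quantizer that rounds down to a multiple of `1 / s` in `[-s, s]`. -/
noncomputable def gridQuantizer (s : ℕ) (x : ℝ) : ℝ :=
  (max (-(s : ℤ) ^ 2) (min ((s : ℤ) ^ 2) ⌊s * x⌋) : ℤ) / s

lemma measurable_gridQuantizer (s : ℕ) : Measurable (gridQuantizer s) := by
  have h1 : Measurable fun z : ℤ => ((max (-(s : ℤ) ^ 2) (min ((s : ℤ) ^ 2) z) : ℤ) : ℝ) / s :=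
    measurable_of_countable _
  exact h1.comp (Int.measurable_floor.comp (measurable_const_mul (s : ℝ)))

lemma isQuantization_gridQuantizer (s : ℕ) {M : ℕ} (hM : 2 * s ^ 2 + 1 ≤ M) {Z : Ω → ℝ}
    (hZ : Measurable Z) : IsQuantization (fun ω => gridQuantizer s (Z ω)) M := by
  refine isQuantization_comp_of_forall_mem (measurable_gridQuantizer s)
    (s := (Finset.Icc (-(s : ℤ) ^ 2) ((s : ℤ) ^ 2)).image fun z : ℤ => (z : ℝ) / s)
    (Finset.card_image_le.trans ?_) (fun x => ?_) hZ
  · rw [Int.card_Icc]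
    zify at hM ⊢
    rw [Int.toNat_of_nonneg (by linarith [sq_nonneg (s : ℤ)])]
    linarith
  · refine Finset.mem_image_of_mem _ (Finset.mem_Icc.2 ⟨le_max_left _ _, max_le ?_ (min_le_left _ _)⟩)
    have : 0 ≤ (s : ℤ) ^ 2 := by positivity
    linarith

/-- Without truncation the rounding error is at most `1 / s`; where truncation acts, `|x| > s`, and
`|x| - s ≤ x² / s`. -/
lemma abs_sub_gridQuantizer_le {s : ℕ} (hs : 1 ≤ s) (x : ℝ) :
    |x - gridQuantizer s x| ≤ (1 + x ^ 2) / s := by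
  have hs' : (1 : ℝ) ≤ s := by exact_mod_cast hs
  have hs0 : (0 : ℝ) < s := by linarith
  rw [gridQuantizer]
  have hfl := Int.floor_le (s * x)
  have hlt := Int.lt_floor_add_one (s * x)
  set z := ⌊s * x⌋
  rcases le_or_gt z ((s : ℤ) ^ 2) with h1 | h1
  · rcases le_or_gt (-(s : ℤ) ^ 2) z with h2 | h2
    · rw [min_eq_right h1, max_eq_right h2, le_div_iff₀ hs0, ← abs_of_pos hs0, ← abs_mul,
        abs_of_pos hs0, sub_mul, div_mul_cancel₀ _ hs0.ne', mul_comm x, abs_of_nonneg (by linarith)]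
      nlinarith [sq_nonneg x]
    · have h3 : (z : ℝ) + 1 ≤ -(s : ℝ) ^ 2 := by exact_mod_cast h2
      rw [min_eq_right h1, max_eq_left h2.le]
      push_cast
      have hx : x < -s := by nlinarith
      have h4 : -(s : ℝ) ^ 2 / s = -s := by field_simp
      rw [h4, le_div_iff₀ hs0, abs_of_neg (by linarith)]
      nlinarith
  · have h3 : (s : ℝ) ^ 2 + 1 ≤ z := by exact_mod_cast h1
    rw [min_eq_left h1.le, max_eq_right (by have : 0 ≤ (s : ℤ) ^ 2 := by positivity
                                            linarith)]
    push_cast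
    have hx : s < x := by nlinarith
    have h4 : (s : ℝ) ^ 2 / s = s := by field_simp
    rw [h4, le_div_iff₀ hs0, abs_of_pos (by linarith)]
    nlinarith

lemma exists_lintegral_one_add_sq_rpow_le {r : ℝ} (hr : 0 < r) :
    ∃ c : ℝ, 0 < c ∧ ∫⁻ x, ENNReal.ofReal ((1 + x ^ 2) ^ r) ∂(gaussianReal 0 1) ≤
      ENNReal.ofReal c := by
  obtain ⟨c, hc, hc'⟩ := exists_one_add_rpow_le_mul_exp r
  refine ⟨4 ^ r * c * 2, by positivity, ?_⟩
  calc _ ≤ ∫⁻ x : ℝ, ENNReal.ofReal (4 ^ r * c) * ENNReal.ofReal (Real.exp (x ^ 2 / 4))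
        ∂(gaussianReal 0 1) := by
        refine lintegral_mono fun x => ?_
        rw [← ENNReal.ofReal_mul (by positivity)]
        refine ENNReal.ofReal_le_ofReal ?_
        calc (1 + x ^ 2) ^ r ≤ (4 * (1 + x ^ 2 / 4)) ^ r := by
              refine Real.rpow_le_rpow (by positivity) (by linarith) hr.le
          _ = 4 ^ r * (1 + x ^ 2 / 4) ^ r := Real.mul_rpow (by norm_num) (by positivity)
          _ ≤ 4 ^ r * (c * Real.exp (x ^ 2 / 4)) := by
            gcongr
            exact hc' _ (by positivity)
          _ = _ := by ring
    _ ≤ ENNReal.ofReal (4 ^ r * c) * 2 := by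
        rw [lintegral_const_mul' _ _ ENNReal.ofReal_ne_top]
        gcongr
        exact lintegral_exp_sq_div_four_gaussianReal
    _ = _ := by
        rw [ENNReal.ofReal_mul (by positivity : 0 ≤ 4 ^ r * c), ENNReal.ofReal_ofNat]

lemma lintegral_enorm_rpow_gaussianReal_lt_top {r : ℝ} (hr : 0 < r) :
    ∫⁻ x, ‖x‖ₑ ^ r ∂(gaussianReal 0 1) < ∞ := by
  obtain ⟨c, -, hc⟩ := exists_lintegral_one_add_sq_rpow_le hr
  refine (lintegral_mono fun x => ?_).trans_lt (hc.trans_lt ENNReal.ofReal_lt_top)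
  rw [← ofReal_norm, ENNReal.ofReal_rpow_of_nonneg (norm_nonneg _) hr.le]
  refine ENNReal.ofReal_le_ofReal (Real.rpow_le_rpow (norm_nonneg _) ?_ hr.le)
  rw [Real.norm_eq_abs]
  nlinarith [sq_nonneg (|x| - 1), sq_abs x, abs_nonneg x]

/-- Optimal quantizations of a standard normal variable at level `M ≥ 2 s ^ 2 + 1` have an error of
order at most `1 / s`. -/
lemma exists_lintegral_optimal_le {r : ℝ} (hr : 0 < r) :
    ∃ c : ℝ, 0 < c ∧ ∀ {Ω : Type*} [MeasurableSpace Ω] (Q : Measure Ω) (Z Y : Ω → ℝ) (s M : ℕ),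
      HasLaw Z (gaussianReal 0 1) Q → 1 ≤ s → 2 * s ^ 2 + 1 ≤ M →
      IsOptimalQuantization Z Y Q M r →
      ∫⁻ ω, ‖Z ω - Y ω‖ₑ ^ r ∂Q ≤ ENNReal.ofReal (c * (1 / (s : ℝ)) ^ r) := by
  obtain ⟨c, hc0, hc⟩ := exists_lintegral_one_add_sq_rpow_le hr
  refine ⟨c, hc0, fun Q Z Y s M hZ hs hM hY => ?_⟩
  have h1 : lrError Z Y Q r ≤ lrError Z (fun ω => gridQuantizer s (hZ.aemeasurable.mk Z ω)) Q r := by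
    rw [hY.2]
    exact iInf_le_of_le _ (iInf_le _
      (isQuantization_gridQuantizer s hM hZ.aemeasurable.measurable_mk))
  rw [lrError, lrError, ENNReal.rpow_le_rpow_iff (one_div_pos.2 hr)] at h1
  refine h1.trans ?_
  have h2 : ∀ᵐ ω ∂Q, ‖Z ω - gridQuantizer s (hZ.aemeasurable.mk Z ω)‖ₑ ^ r ≤
      ENNReal.ofReal ((1 / (s : ℝ)) ^ r) * ENNReal.ofReal ((1 + Z ω ^ 2) ^ r) := by
    filter_upwards [hZ.aemeasurable.ae_eq_mk] with ω hω
    rw [← hω, ← ofReal_norm, ENNReal.ofReal_rpow_of_nonneg (norm_nonneg _) hr.le,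
      ← ENNReal.ofReal_mul (by positivity), ← Real.mul_rpow (by positivity) (by positivity)]
    refine ENNReal.ofReal_le_ofReal (Real.rpow_le_rpow (norm_nonneg _) ?_ hr.le)
    rw [Real.norm_eq_abs, one_div_mul_eq_div]
    exact abs_sub_gridQuantizer_le hs _
  refine (lintegral_mono_ae h2).trans ?_
  rw [lintegral_const_mul' _ _ ENNReal.ofReal_ne_top,
    hZ.lintegral_comp (f := fun x => ENNReal.ofReal ((1 + x ^ 2) ^ r)) (by fun_prop), mul_comm c,
    ENNReal.ofReal_mul (by positivity)]
  gcongr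

end GridQuantizer

/-! ### Combining the tail with the coordinate errors -/

section ProductQuantization

/-- Bounding the sum by its largest term is crude, but it treats `r < 1` and `r ≥ 1` alike. -/
lemma ENNReal.sum_rpow_le {ι : Type*} (s : Finset ι) (a : ι → ℝ≥0∞) {r : ℝ} (hr : 0 < r) :
    (∑ j ∈ s, a j) ^ r ≤ (s.card : ℝ≥0∞) ^ r * ∑ j ∈ s, a j ^ r := by
  rcases s.eq_empty_or_nonempty with rfl | hs
  · simp [hr]
  obtain ⟨i, hi, hmax⟩ := s.exists_max_image a hs
  calc (∑ j ∈ s, a j) ^ r ≤ (s.card * a i) ^ r := by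
        refine ENNReal.rpow_le_rpow ?_ hr.le
        simpa using Finset.sum_le_card_nsmul s a (a i) hmax
    _ = (s.card : ℝ≥0∞) ^ r * a i ^ r := ENNReal.mul_rpow_of_nonneg _ _ hr.le
    _ ≤ _ := by
        gcongr
        exact Finset.single_le_sum (f := fun j => a j ^ r) (fun _ _ => zero_le) hi

variable {Ω E : Type*} [MeasurableSpace Ω] {Q : Measure Ω} [NormedAddCommGroup E] [NormedSpace ℝ E]

/-- The coordinate errors are added without using independence. The loss `m ^ (r + 1)` is affordable
because `b` will be a high negative power of `m`. -/
lemma lintegral_sub_sum_rpow_le {f : ℕ → E} {ξ ξhat : ℕ → Ω → ℝ} {S : Ω → E} {m : ℕ} {r : ℝ}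
    (hr : 0 < r) {C : ℝ} (hC : ∀ j, ‖f j‖ ≤ C) {a b : ℝ≥0∞}
    (hξ : ∀ j, AEMeasurable (ξ j) Q) (hξhat : ∀ j < m, AEMeasurable (ξhat j) Q)
    (ha : ∫⁻ ω, ‖S ω - ∑ j ∈ Finset.range m, ξ j ω • f j‖ₑ ^ r ∂Q ≤ a)
    (hb : ∀ j < m, ∫⁻ ω, ‖ξ j ω - ξhat j ω‖ₑ ^ r ∂Q ≤ b) :
    ∫⁻ ω, ‖S ω - ∑ j ∈ Finset.range m, ξhat j ω • f j‖ₑ ^ r ∂Q ≤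
      2 ^ r * (a + (m : ℝ≥0∞) ^ r * (m * (b * ENNReal.ofReal C ^ r))) := by
  have hmeas : ∀ j ∈ Finset.range m,
      AEMeasurable (fun ω => (‖ξ j ω - ξhat j ω‖ₑ * ENNReal.ofReal C) ^ r) Q := by
    intro j hj
    have h1 := hξ j
    have h2 := hξhat j (Finset.mem_range.1 hj)
    fun_prop
  have hpt : ∀ ω, ‖S ω - ∑ j ∈ Finset.range m, ξhat j ω • f j‖ₑ ^ r ≤
      2 ^ r * (‖S ω - ∑ j ∈ Finset.range m, ξ j ω • f j‖ₑ ^ r + (m : ℝ≥0∞) ^ r *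
        ∑ j ∈ Finset.range m, (‖ξ j ω - ξhat j ω‖ₑ * ENNReal.ofReal C) ^ r) := by
    intro ω
    set u := ‖S ω - ∑ j ∈ Finset.range m, ξ j ω • f j‖ₑ
    set v := ∑ j ∈ Finset.range m, ‖ξ j ω - ξhat j ω‖ₑ * ENNReal.ofReal C with hv
    have h1 : ‖S ω - ∑ j ∈ Finset.range m, ξhat j ω • f j‖ₑ ≤ u + v := by
      have : S ω - ∑ j ∈ Finset.range m, ξhat j ω • f j =
          (S ω - ∑ j ∈ Finset.range m, ξ j ω • f j) +
            ∑ j ∈ Finset.range m, (ξ j ω - ξhat j ω) • f j := by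
        simp only [sub_smul, Finset.sum_sub_distrib]
        abel
      rw [this]
      refine (enorm_add_le _ _).trans (add_le_add le_rfl ?_)
      refine (enorm_sum_le _ _).trans (Finset.sum_le_sum fun j _ => ?_)
      rw [enorm_smul]
      gcongr
      rw [← ofReal_norm]
      exact ENNReal.ofReal_le_ofReal (hC j)
    have h2 : (u + v) ^ r ≤ 2 ^ r * (u ^ r + v ^ r) := by
      simpa using ENNReal.sum_rpow_le Finset.univ ![u, v] hr
    refine (ENNReal.rpow_le_rpow h1 hr.le).trans (h2.trans ?_)
    gcongr
    simpa using ENNReal.sum_rpow_le (Finset.range m) _ hr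
  refine (lintegral_mono hpt).trans ?_
  rw [lintegral_const_mul' _ _ (by finiteness), lintegral_add_right' _
    ((Finset.aemeasurable_fun_sum _ hmeas).const_mul _), lintegral_const_mul' _ _ (by finiteness),
    lintegral_finsetSum' _ hmeas]
  gcongr
  calc _ ≤ ∑ j ∈ Finset.range m, b * ENNReal.ofReal C ^ r := by
        refine Finset.sum_le_sum fun j hj => ?_
        simp_rw [ENNReal.mul_rpow_of_nonneg _ _ hr.le]
        rw [lintegral_mul_const' _ _ (by finiteness)]
        gcongr
        exact hb j (Finset.mem_range.1 hj)
    _ = _ := by simp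

/-- Take `m = ⌊L / (q l)⌋` with `L = log N`, `l = log L`. Then `log m ≤ l` gives `m q log m ≤ L`,
and `m ≥ L / (2 q l)` with `log (m + 1) ≤ 2 l` gives the rate. -/
lemma eventually_exists_product_level {q : ℕ} (hq : 1 ≤ q) :
    ∀ᶠ N : ℕ in atTop, ∃ m : ℕ, 3 ≤ m ∧ (m ^ q) ^ m ≤ N ∧ √(Real.log (m + 1) / m) ≤
      2 * √q * (Real.log (Real.log N) / Real.log N ^ (1 / 2 : ℝ)) := by
  have hlogN : Tendsto (fun N : ℕ => Real.log N) atTop atTop :=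
    Real.tendsto_log_atTop.comp tendsto_natCast_atTop_atTop
  have hdiv : Tendsto (fun x : ℝ => x / Real.log x) atTop atTop := by
    have h1 : Tendsto (fun x : ℝ => Real.log x / x) atTop (𝓝[>] 0) := by
      refine tendsto_nhdsWithin_iff.2 ⟨?_, ?_⟩
      · simpa using Real.isLittleO_log_id_atTop.tendsto_div_nhds_zero
      · filter_upwards [eventually_gt_atTop 1] with x hx
        exact div_pos (Real.log_pos hx) (by linarith)
    refine h1.inv_tendsto_nhdsGT_zero.congr fun x => ?_
    simp
  filter_upwards [hlogN.eventually_ge_atTop (Real.exp 1), hlogN.eventually_ge_atTop 2,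
    (hdiv.comp hlogN).eventually_ge_atTop (3 * q), eventually_gt_atTop 0] with N hN1 hN2 hN3 hN0
  simp only [Function.comp_apply] at hN3
  set L := Real.log N with hL
  set l := Real.log L with hl
  have hq' : (1 : ℝ) ≤ q := by exact_mod_cast hq
  have hl1 : 1 ≤ l := by rwa [hl, Real.le_log_iff_exp_le (by linarith)]
  have hL0 : 0 < L := by linarith
  have hx3 : 3 ≤ L / (q * l) := by
    rw [le_div_iff₀ (by linarith)] at hN3
    rw [le_div_iff₀ (by positivity)]
    linarith
  set m := ⌊L / (q * l)⌋₊ with hm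
  have hm3 : 3 ≤ m := Nat.le_floor (by exact_mod_cast hx3)
  have hm3' : (3 : ℝ) ≤ m := by exact_mod_cast hm3
  have hmle : (m : ℝ) ≤ L / (q * l) := Nat.floor_le (by linarith)
  have hlt := Nat.lt_floor_add_one (L / (q * l))
  rw [← hm] at hlt
  have hmge : L / (2 * q * l) ≤ m := by
    have : L / (2 * q * l) = L / (q * l) / 2 := by field_simp
    rw [this]
    linarith
  have hmL : (m : ℝ) ≤ L := by
    refine hmle.trans (div_le_self hL0.le ?_)
    nlinarith
  have hlogm : Real.log m ≤ l := Real.log_le_log (by linarith) hmL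
  have hlogm1 : Real.log (m + 1) ≤ 2 * l := by
    have : Real.log (m + 1) ≤ Real.log (L ^ 2) := Real.log_le_log (by linarith) (by nlinarith)
    rwa [Real.log_pow] at this
  refine ⟨m, hm3, ?_, ?_⟩
  · have h1 : ((m ^ q) ^ m : ℝ) ≤ N := by
      rw [← Real.log_le_log_iff (by positivity) (by exact_mod_cast hN0), Real.log_pow,
        Real.log_pow, ← hL]
      rw [le_div_iff₀ (by positivity)] at hmle
      calc (m : ℝ) * (q * Real.log m) ≤ m * (q * l) := by gcongr
        _ ≤ L := hmle
    exact_mod_cast h1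
  · rw [Real.sqrt_le_left (by positivity), mul_pow, mul_pow, div_pow, ← Real.sqrt_eq_rpow,
      Real.sq_sqrt hL0.le, Real.sq_sqrt (by linarith)]
    calc Real.log (m + 1) / m ≤ 2 * l / (L / (2 * q * l)) := by gcongr
      _ = _ := by field_simp

end ProductQuantization

/-! ### The Ornstein–Uhlenbeck expansion -/

section OUSeq

variable {T β σ : ℝ}

/-- The frequency `π (j + 1/2) / T`. -/
noncomputable def ouFreq (T : ℝ) (j : ℕ) : ℝ := Real.pi * (((j + 1 : ℕ) : ℝ) - 1 / 2) / T

lemma ouFreq_pos (hT : 0 < T) (j : ℕ) : 0 < ouFreq T j := by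
  have : (0 : ℝ) < ((j + 1 : ℕ) : ℝ) - 1 / 2 := by
    push_cast
    have := Nat.cast_nonneg (α := ℝ) j
    linarith
  unfold ouFreq
  positivity

/-- The solution of `y' = - β y + cos (l t)`, `y 0 = 0`. -/
noncomputable def ouSol (β l t : ℝ) : ℝ :=
  (β * Real.cos (l * t) + l * Real.sin (l * t) - β * Real.exp (-β * t)) / (β ^ 2 + l ^ 2)

lemma hasDerivAt_ouSol (hβ : 0 < β) (l t : ℝ) :
    HasDerivAt (ouSol β l) (-β * ouSol β l t + Real.cos (l * t)) t := by
  have h1 : HasDerivAt (fun t => l * t) l t := by simpa using (hasDerivAt_id t).const_mul l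
  have h2 : HasDerivAt (fun t => -β * t) (-β) t := by simpa using (hasDerivAt_id t).const_mul (-β)
  have h3 := ((((h1.cos).const_mul β).add ((h1.sin).const_mul l)).sub
    ((h2.exp).const_mul β)).div_const (β ^ 2 + l ^ 2)
  refine h3.congr_deriv ?_
  have : β ^ 2 + l ^ 2 ≠ 0 := by positivity
  unfold ouSol
  field_simp
  ring

/-- Variation of constants: `exp (-β (t - s)) * ouSol β l s` is an antiderivative of the integrand.
-/
lemma integral_exp_mul_cos (hβ : 0 < β) (l t : ℝ) :
    ∫ s in (0 : ℝ)..t, Real.exp (-β * (t - s)) * Real.cos (l * s) = ouSol β l t := by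
  have h : ∀ s ∈ Set.uIcc 0 t, HasDerivAt (fun s => Real.exp (-β * (t - s)) * ouSol β l s)
      (Real.exp (-β * (t - s)) * Real.cos (l * s)) s := by
    intro s _
    have h1 : HasDerivAt (fun s => -β * (t - s)) β s := by
      simpa using ((hasDerivAt_id s).const_sub t).const_mul (-β)
    refine (h1.exp.mul (hasDerivAt_ouSol hβ l s)).congr_deriv ?_
    ring
  rw [intervalIntegral.integral_eq_sub_of_hasDerivAt h
    (Continuous.intervalIntegrable (by fun_prop) _ _)]
  simp [ouSol]

lemma abs_ouSol_le (hβ : 0 < β) {l : ℝ} (hl : 0 < l) {t : ℝ} (ht : 0 ≤ t) :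
    |ouSol β l t| ≤ 3 / l := by
  rw [ouSol, abs_div, abs_of_pos (by positivity : 0 < β ^ 2 + l ^ 2),
    div_le_div_iff₀ (by positivity) hl]
  have h1 := Real.neg_one_le_cos (l * t)
  have h2 := Real.cos_le_one (l * t)
  have h3 := Real.neg_one_le_sin (l * t)
  have h4 := Real.sin_le_one (l * t)
  have h5 := Real.exp_pos (-β * t)
  have h6 : Real.exp (-β * t) ≤ 1 := Real.exp_le_one_iff.2 (by nlinarith)
  have h7 : |β * Real.cos (l * t) + l * Real.sin (l * t) - β * Real.exp (-β * t)| ≤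
      2 * β + l := by
    rw [abs_le]
    constructor <;> nlinarith
  calc _ ≤ (2 * β + l) * l := by gcongr
    _ ≤ _ := by nlinarith [sq_nonneg (β - l)]

/-- The differential equation bounds the derivative by `β |y| + 1`. -/
lemma abs_ouSol_sub_le (hβ : 0 < β) {l : ℝ} (hl : 0 < l) {s t : ℝ} (hs : 0 ≤ s) (ht : 0 ≤ t) :
    |ouSol β l s - ouSol β l t| ≤ (β * (3 / l) + 1) * |s - t| := by
  have := Convex.norm_image_sub_le_of_norm_hasDerivWithin_le (f := ouSol β l)
    (f' := fun t => -β * ouSol β l t + Real.cos (l * t)) (C := β * (3 / l) + 1)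
    (s := Set.Ici (0 : ℝ)) (fun x _ => (hasDerivAt_ouSol hβ l x).hasDerivWithinAt)
    (fun x hx => ?_) (convex_Ici 0) (x := t) (y := s) ht hs
  · simpa [Real.norm_eq_abs] using this
  · rw [Real.norm_eq_abs]
    refine (abs_add_le _ _).trans (add_le_add ?_ (Real.abs_cos_le_one _))
    rw [abs_mul, abs_neg, abs_of_pos hβ]
    gcongr
    exact abs_ouSol_le hβ hl hx

lemma ouSeq_zero_apply (t : Set.Icc (0 : ℝ) T) :
    ouSeq T β σ 0 t = σ / √(2 * β) * Real.exp (-β * t) := rfl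

lemma ouSeq_succ_apply (hβ : 0 < β) (j : ℕ) (t : Set.Icc (0 : ℝ) T) :
    ouSeq T β σ (j + 1) t = σ * √(2 / T) * ouSol β (ouFreq T j) t := by
  rw [← integral_exp_mul_cos hβ]
  simp only [ouSeq, ContinuousMap.coe_mk, ouFreq]
  congr 1
  refine intervalIntegral.integral_congr fun s _ => ?_
  congr 2
  ring

lemma three_div_ouFreq_le (hT : 0 < T) (j : ℕ) : 3 / ouFreq T j ≤ 4 * T / (j + 2) := by
  rw [div_le_div_iff₀ (ouFreq_pos hT j) (by positivity), ouFreq, ← mul_div_assoc, le_div_iff₀ hT]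
  push_cast
  have hj := Nat.cast_nonneg (α := ℝ) j
  have := Real.pi_gt_three
  nlinarith [mul_pos hT hT, mul_nonneg hT.le hj, mul_nonneg (mul_pos hT hT).le hj,
    mul_nonneg (mul_nonneg (mul_pos hT hT).le hj) (by linarith : 0 ≤ Real.pi - 3),
    mul_nonneg (mul_pos hT hT).le (by linarith : 0 ≤ Real.pi - 3)]

lemma exists_norm_ouSeq_le (hT : 0 < T) (hβ : 0 < β) (hσ : 0 < σ) :
    ∃ C : ℝ, 0 < C ∧ (∀ j : ℕ, ‖ouSeq T β σ j‖ ≤ C / (j + 1)) ∧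
      ∀ (j : ℕ) (s t : Set.Icc (0 : ℝ) T),
        |ouSeq T β σ j s - ouSeq T β σ j t| ≤ C * (j + 1) * |(s : ℝ) - t| := by
  set A := σ / √(2 * β) with hA
  set D := σ * √(2 / T) with hD
  have hA0 : 0 < A := by positivity
  have hD0 : 0 < D := by positivity
  refine ⟨A * (1 + β) + D * (4 * T) + D * (β * (4 * T) + 1), by positivity, fun j => ?_,
    fun j s t => ?_⟩
  · refine (ContinuousMap.norm_le _ (by positivity)).2 fun t => ?_
    rw [Real.norm_eq_abs]
    obtain _ | j := j
    · rw [ouSeq_zero_apply, ← hA, abs_of_pos (by positivity)]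
      have h1 : Real.exp (-β * t) ≤ 1 := Real.exp_le_one_iff.2 (by nlinarith [t.2.1])
      have h2 : A * Real.exp (-β * t) ≤ A := mul_le_of_le_one_right hA0.le h1
      have h3 : 0 ≤ A * β + D * (4 * T) + D * (β * (4 * T) + 1) := by positivity
      simp only [Nat.cast_zero, zero_add, div_one]
      linarith
    · rw [ouSeq_succ_apply hβ, ← hD, abs_mul, abs_of_pos hD0]
      calc _ ≤ D * (4 * T / (j + 2)) := by
            gcongr
            exact (abs_ouSol_le hβ (ouFreq_pos hT j) t.2.1).trans (three_div_ouFreq_le hT j)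
        _ = D * (4 * T) / ((j + 1 : ℕ) + 1) := by
            push_cast
            rw [← mul_div_assoc]
            congr 1
            ring
        _ ≤ _ := by
            gcongr
            have h3 : 0 ≤ A * (1 + β) + D * (β * (4 * T) + 1) := by positivity
            linarith
  · have hj := Nat.cast_nonneg (α := ℝ) j
    -- The Lipschitz constants are in fact bounded in `j`; the factor `j + 1` is slack.
    suffices h : |ouSeq T β σ j s - ouSeq T β σ j t| ≤
        (A * (1 + β) + D * (4 * T) + D * (β * (4 * T) + 1)) * |(s : ℝ) - t| by
      refine h.trans ?_
      gcongr
      refine le_mul_of_one_le_right (by positivity) (by linarith)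
    obtain _ | j := j
    · rw [ouSeq_zero_apply, ouSeq_zero_apply, ← hA, ← mul_sub, abs_mul, abs_of_pos hA0]
      have := Convex.norm_image_sub_le_of_norm_hasDerivWithin_le
        (f := fun t : ℝ => Real.exp (-β * t)) (f' := fun t => Real.exp (-β * t) * -β) (C := β)
        (s := Set.Ici (0 : ℝ)) (fun x _ => ?_) (fun x hx => ?_) (convex_Ici 0) (x := t) (y := s)
        t.2.1 s.2.1
      · simp only [Real.norm_eq_abs] at this
        calc _ ≤ A * (β * |(s : ℝ) - t|) := by gcongr
          _ = A * β * |(s : ℝ) - t| := by ring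
          _ ≤ _ := by
            gcongr
            have : 0 ≤ A + D * (4 * T) + D * (β * (4 * T) + 1) := by positivity
            linarith
      · have h2 : HasDerivAt (fun t => -β * t) (-β) x := by
          simpa using (hasDerivAt_id x).const_mul (-β)
        exact h2.exp.hasDerivWithinAt
      · rw [Real.norm_eq_abs, abs_mul, abs_neg, abs_of_pos hβ, abs_of_pos (Real.exp_pos _)]
        have hx' : (0 : ℝ) ≤ x := hx
        exact mul_le_of_le_one_left hβ.le (Real.exp_le_one_iff.2 (by nlinarith))
    · rw [ouSeq_succ_apply hβ, ouSeq_succ_apply hβ, ← hD, ← mul_sub, abs_mul, abs_of_pos hD0]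
      have h1 : 3 / ouFreq T j ≤ 4 * T := (three_div_ouFreq_le hT j).trans
        (div_le_self (by positivity) (by linarith [Nat.cast_nonneg (α := ℝ) j]))
      calc _ ≤ D * ((β * (3 / ouFreq T j) + 1) * |(s : ℝ) - t|) := by
            gcongr
            exact abs_ouSol_sub_le hβ (ouFreq_pos hT j) s.2.1 t.2.1
        _ ≤ D * ((β * (4 * T) + 1) * |(s : ℝ) - t|) := by gcongr
        _ = D * (β * (4 * T) + 1) * |(s : ℝ) - t| := by ring
        _ ≤ _ := by
            gcongr
            have h3 : 0 ≤ A * (1 + β) + D * (4 * T) := by positivity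
            linarith

lemma satisfiesA1_ouSeq (hT : 0 < T) (hβ : 0 < β) (hσ : 0 < σ) :
    SatisfiesA1 (ouSeq T β σ) 1 0 := by
  obtain ⟨C, -, h, -⟩ := exists_norm_ouSeq_le hT hβ hσ
  refine ⟨by norm_num, le_rfl, C, fun j => (h j).trans (le_of_eq ?_)⟩
  rw [Real.rpow_zero, mul_one, Real.rpow_neg_one, div_eq_mul_inv]
  push_cast
  rfl

lemma satisfiesA2_ouSeq (hT : 0 < T) (hβ : 0 < β) (hσ : 0 < σ) :
    SatisfiesA2 (ouSeq T β σ) 1 1 := by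
  obtain ⟨C, -, -, h⟩ := exists_norm_ouSeq_le hT hβ hσ
  refine ⟨one_pos, le_rfl, C, fun j s t => ?_⟩
  simpa only [Real.rpow_one, Nat.cast_add, Nat.cast_one] using h j s t

end OUSeq

/-! ### Fourier series and the Brownian covariance -/

section Parseval

/-- Replace the terms and the value of a convergent series by equal ones. -/
lemma HasSum.of_eq {f g : ℕ → ℝ} {a b : ℝ} (h : HasSum f a) (hf : ∀ n, f n = g n) (ha : a = b) :
    HasSum g b := by
  rw [← ha, ← funext hf]
  exact h

/-- The Fourier series of the second Bernoulli polynomial. The term `n = 0` vanishes because `1 / 0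
= 0`. -/
lemma hasSum_cos_div_sq {x : ℝ} (hx : x ∈ Set.Icc (0 : ℝ) 1) :
    HasSum (fun n : ℕ => 1 / (n : ℝ) ^ 2 * Real.cos (2 * Real.pi * n * x))
      (Real.pi ^ 2 * (x ^ 2 - x + 1 / 6)) := by
  have h : (Polynomial.map (algebraMap ℚ ℝ) (Polynomial.bernoulli 2)).eval x =
      x ^ 2 - x + 1 / 6 := by
    simp [Polynomial.bernoulli, Finset.sum_range_succ, Polynomial.map_monomial, bernoulli_two,
      Polynomial.eval_monomial, bernoulli_one]
    ring
  refine (hasSum_one_div_nat_pow_mul_cos one_ne_zero hx).of_eq (fun n => rfl) ?_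
  have h2 : ((Nat.factorial 2 : ℕ) : ℝ) = 2 := by norm_num [Nat.factorial]
  rw [mul_one, h, h2]
  ring

/-- The even terms form a quarter of the full series at `2x`, where `θ = 2πx`; `θ ≤ π` keeps `2x` in
`[0, 1]`. In the difference the quadratic terms cancel. -/
lemma hasSum_cos_odd_div_sq {θ : ℝ} (h0 : 0 ≤ θ) (hπ : θ ≤ Real.pi) :
    HasSum (fun n : ℕ => 1 / (2 * (n : ℝ) + 1) ^ 2 * Real.cos ((2 * n + 1) * θ))
      (Real.pi ^ 2 / 8 - Real.pi * θ / 4) := by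
  have hpi := Real.pi_pos
  obtain ⟨x, rfl⟩ : ∃ x, θ = 2 * Real.pi * x := ⟨θ / (2 * Real.pi), by field_simp⟩
  have hx0 : 0 ≤ x := nonneg_of_mul_nonneg_right h0 (by positivity)
  have hx1 : x ≤ 1 / 2 := by
    by_contra! h
    nlinarith
  have hall := hasSum_cos_div_sq (x := x) ⟨hx0, by linarith⟩
  have heven := (hasSum_cos_div_sq (x := 2 * x) ⟨by linarith, by linarith⟩).mul_left (1 / 4)
  obtain ⟨v, hodd⟩ : Summable fun n : ℕ => 1 / ((2 * n + 1 : ℕ) : ℝ) ^ 2 *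
      Real.cos (2 * Real.pi * (2 * n + 1 : ℕ) * x) :=
    hall.summable.comp_injective (i := fun n : ℕ => 2 * n + 1) fun a b h => by simpa using h
  have heven' : HasSum (fun n : ℕ => 1 / ((2 * n : ℕ) : ℝ) ^ 2 *
      Real.cos (2 * Real.pi * (2 * n : ℕ) * x))
      (1 / 4 * (Real.pi ^ 2 * ((2 * x) ^ 2 - 2 * x + 1 / 6))) := by
    refine heven.of_eq (fun n => ?_) rfl
    push_cast
    rw [show 2 * Real.pi * (2 * (n : ℝ)) * x = 2 * Real.pi * n * (2 * x) by ring]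
    rw [mul_pow, one_div (2 ^ 2 * _), mul_inv]
    norm_num
    ring
  have hval := (HasSum.even_add_odd
    (f := fun n : ℕ => 1 / (n : ℝ) ^ 2 * Real.cos (2 * Real.pi * n * x)) heven' hodd).unique hall
  refine hodd.of_eq (fun n => ?_) ?_
  · push_cast
    rw [show 2 * Real.pi * (2 * (n : ℝ) + 1) * x = (2 * n + 1) * (2 * Real.pi * x) by ring]
  · linear_combination hval

/-- The Karhunen–Loève expansion of the covariance function of Brownian motion. -/
lemma hasSum_sin_mul_sin {T : ℝ} (hT : 0 < T) {s t : ℝ} (hs : s ∈ Set.Icc 0 T)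
    (ht : t ∈ Set.Icc 0 T) :
    HasSum (fun j : ℕ => √(2 / T) * (Real.sin (ouFreq T j * s) / ouFreq T j) *
      (√(2 / T) * (Real.sin (ouFreq T j * t) / ouFreq T j))) (min s t) := by
  have hpi := Real.pi_pos
  have h1 := hasSum_cos_odd_div_sq (θ := Real.pi * |s - t| / (2 * T)) (by positivity) (by
    rw [div_le_iff₀ (by positivity)]
    have : |s - t| ≤ T := by
      rw [abs_le]
      constructor <;> linarith [hs.1, hs.2, ht.1, ht.2]
    nlinarith)
  have h2 := hasSum_cos_odd_div_sq (θ := Real.pi * (s + t) / (2 * T))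
    (by have := hs.1; have := ht.1; positivity) (by
    rw [div_le_iff₀ (by positivity)]
    nlinarith [hs.2, ht.2])
  -- Product-to-sum for the sines on one side, `min s t = (s + t - |s - t|) / 2` on the other.
  refine ((h1.sub h2).mul_left (4 * T / Real.pi ^ 2)).of_eq (fun j => ?_) ?_
  · have hl := ouFreq_pos hT j
    have hj : ouFreq T j = (2 * j + 1) * Real.pi / (2 * T) := by
      rw [ouFreq]
      push_cast
      field_simp
      ring
    have e1 : Real.cos ((2 * j + 1) * (Real.pi * |s - t| / (2 * T))) =
        Real.cos (ouFreq T j * s - ouFreq T j * t) := by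
      rw [← Real.cos_abs (ouFreq T j * s - _), ← mul_sub, abs_mul, abs_of_pos hl, hj]
      congr 1
      ring
    have e2 : Real.cos ((2 * j + 1) * (Real.pi * (s + t) / (2 * T))) =
        Real.cos (ouFreq T j * s + ouFreq T j * t) := by
      rw [← mul_add, hj]
      congr 1
      ring
    have e3 : 1 / (2 * (j : ℝ) + 1) ^ 2 = Real.pi ^ 2 / (4 * T ^ 2) / ouFreq T j ^ 2 := by
      rw [hj]
      field_simp
      norm_num
    rw [e1, e2, e3, Real.cos_sub, Real.cos_add, mul_mul_mul_comm, Real.mul_self_sqrt (by positivity)]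
    field_simp
    ring
  · have : min s t = (s + t - |s - t|) / 2 := by
      rcases le_total s t with h | h
      · rw [min_eq_left h, abs_of_nonpos (by linarith)]
        ring
      · rw [min_eq_right h, abs_of_nonneg (by linarith)]
        ring
    rw [this]
    field_simp
    ring

end Parseval

/-! ### Recovering the noise from the path -/

section Noise

variable {T β σ : ℝ}

/-- The functional `x ↦ ∫_0^t x(s) ds` on the path space. -/
noncomputable def pathIntegral (hT : 0 ≤ T) (t : Set.Icc (0 : ℝ) T) : PathSpace T →L[ℝ] ℝ :=
  LinearMap.mkContinuous
    { toFun := fun x => ∫ s in (0 : ℝ)..t, Set.IccExtend hT x s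
      map_add' := fun x y => by
        rw [← intervalIntegral.integral_add (x.continuous.Icc_extend'.intervalIntegrable _ _)
          (y.continuous.Icc_extend'.intervalIntegrable _ _)]
        rfl
      map_smul' := fun c x => by
        rw [RingHom.id_apply, smul_eq_mul, ← intervalIntegral.integral_const_mul]
        rfl } T fun x => by
    have := intervalIntegral.norm_integral_le_of_norm_le_const (a := 0) (b := t)
      (f := Set.IccExtend hT x) (C := ‖x‖) fun s _ => x.norm_coe_le_norm _
    refine this.trans ?_
    rw [sub_zero, abs_of_nonneg t.2.1, mul_comm]
    gcongr
    exact t.2.2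

/-- The functional `x ↦ x(t) - x(0) + β ∫_0^t x(s) ds`, which recovers the driving noise of the
Langevin equation from its solution. -/
noncomputable def langevinNoise (hT : 0 ≤ T) (β : ℝ) (t : Set.Icc (0 : ℝ) T) :
    PathSpace T →L[ℝ] ℝ :=
  ContinuousMap.evalCLM ℝ t - ContinuousMap.evalCLM ℝ ⟨0, Set.left_mem_Icc.2 hT⟩ +
    β • pathIntegral hT t

lemma langevinNoise_apply (hT : 0 ≤ T) (β : ℝ) (t : Set.Icc (0 : ℝ) T) (x : PathSpace T) :
    langevinNoise hT β t x = x t - x ⟨0, Set.left_mem_Icc.2 hT⟩ +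
      β * ∫ s in (0 : ℝ)..t, Set.IccExtend hT x s := rfl

lemma hasDerivAt_integral_IccExtend (hT : 0 ≤ T) (x : PathSpace T) (t : ℝ) :
    HasDerivAt (fun t => ∫ s in (0 : ℝ)..t, Set.IccExtend hT x s) (Set.IccExtend hT x t) t :=
  x.continuous.Icc_extend'.integral_hasStrictDerivAt 0 t |>.hasDerivAt

/-- The integral `u = ∫ x` solves `u' = -β u` with `u(0) = 0`, so `exp (β t) u(t)` is constant,
equal to `0`. -/
lemma eq_zero_of_langevinNoise_eq_zero (hT : 0 ≤ T) {x : PathSpace T}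
    (h0 : x ⟨0, Set.left_mem_Icc.2 hT⟩ = 0) (h : ∀ t, langevinNoise hT β t x = 0) : x = 0 := by
  have hx : ∀ t : Set.Icc (0 : ℝ) T, x t = -β * ∫ s in (0 : ℝ)..t, Set.IccExtend hT x s := by
    intro t
    have := h t
    rw [langevinNoise_apply, h0] at this
    linarith
  have hc : Continuous (Set.IccExtend hT x) := x.continuous.Icc_extend'
  have hu : Continuous fun t => ∫ s in (0 : ℝ)..t, Set.IccExtend hT x s :=
    continuous_iff_continuousAt.2 fun t => (hasDerivAt_integral_IccExtend hT x t).continuousAt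
  ext t
  have hint := intervalIntegral.integral_eq_sub_of_hasDerivAt (a := 0) (b := t)
    (f := fun t => Real.exp (β * t) * ∫ s in (0 : ℝ)..t, Set.IccExtend hT x s)
    (f' := fun t => Real.exp (β * t) * β * (∫ s in (0 : ℝ)..t, Set.IccExtend hT x s) +
      Real.exp (β * t) * Set.IccExtend hT x t) (fun s _ => by
      have h1 : HasDerivAt (fun t => β * t) β s := by simpa using (hasDerivAt_id s).const_mul β
      exact h1.exp.mul (hasDerivAt_integral_IccExtend hT x s))
    (Continuous.intervalIntegrable (by fun_prop) _ _)
  have hzero : ∀ s ∈ Set.uIcc (0 : ℝ) t, Real.exp (β * s) * β *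
      (∫ s in (0 : ℝ)..s, Set.IccExtend hT x s) + Real.exp (β * s) * Set.IccExtend hT x s = 0 := by
    intro s hs
    rw [Set.uIcc_of_le t.2.1] at hs
    have hsT : s ∈ Set.Icc 0 T := ⟨hs.1, hs.2.trans t.2.2⟩
    rw [Set.IccExtend_of_mem _ _ hsT, hx ⟨s, hsT⟩]
    ring
  rw [intervalIntegral.integral_congr (g := fun _ => 0) hzero] at hint
  simp only [intervalIntegral.integral_zero, intervalIntegral.integral_same, mul_zero,
    sub_zero] at hint
  have hne := Real.exp_ne_zero (β * t)
  rw [hx t, (mul_eq_zero.1 hint.symm).resolve_left hne]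
  simp

lemma continuous_langevinNoise (hT : 0 ≤ T) (x : PathSpace T) :
    Continuous fun t => langevinNoise hT β t x := by
  have hu : Continuous fun t => ∫ s in (0 : ℝ)..t, Set.IccExtend hT x s :=
    continuous_iff_continuousAt.2 fun t => (hasDerivAt_integral_IccExtend hT x t).continuousAt
  simp only [langevinNoise_apply]
  exact (x.continuous.sub continuous_const).add
    (continuous_const.mul (hu.comp continuous_subtype_val))

/-- `f_0` solves the equation without noise. -/
lemma langevinNoise_ouSeq_zero (hT : 0 ≤ T) (hβ : 0 < β) (t : Set.Icc (0 : ℝ) T) :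
    langevinNoise hT β t (ouSeq T β σ 0) = 0 := by
  rw [langevinNoise_apply]
  have h : ∀ s ∈ Set.uIcc (0 : ℝ) t, Set.IccExtend hT (ouSeq T β σ 0) s =
      σ / √(2 * β) * Real.exp (-β * s) := by
    intro s hs
    rw [Set.uIcc_of_le t.2.1] at hs
    rw [Set.IccExtend_of_mem _ _ ⟨hs.1, hs.2.trans t.2.2⟩, ouSeq_zero_apply]
  have hint := intervalIntegral.integral_eq_sub_of_hasDerivAt (a := 0) (b := t)
    (f := fun s => -(1 / β) * Real.exp (-β * s)) (f' := fun s => Real.exp (-β * s)) (fun s _ => by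
      have h1 : HasDerivAt (fun t => -β * t) (-β) s := by
        simpa using (hasDerivAt_id s).const_mul (-β)
      refine (h1.exp.const_mul _).congr_deriv ?_
      field_simp) (Continuous.intervalIntegrable (by fun_prop) _ _)
  rw [intervalIntegral.integral_congr h, intervalIntegral.integral_const_mul, hint,
    ouSeq_zero_apply, ouSeq_zero_apply]
  simp only [mul_zero, Real.exp_zero]
  field_simp
  ring

lemma langevinNoise_ouSeq_succ (hT : 0 < T) (hβ : 0 < β) (j : ℕ) (t : Set.Icc (0 : ℝ) T) :
    langevinNoise hT.le β t (ouSeq T β σ (j + 1)) =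
      σ * (√(2 / T) * (Real.sin (ouFreq T j * t) / ouFreq T j)) := by
  rw [langevinNoise_apply]
  have hl := ouFreq_pos hT j
  set l := ouFreq T j with hldef
  have h : ∀ s ∈ Set.uIcc (0 : ℝ) t, Set.IccExtend hT.le (ouSeq T β σ (j + 1)) s =
      σ * √(2 / T) * ouSol β l s := by
    intro s hs
    rw [Set.uIcc_of_le t.2.1] at hs
    rw [Set.IccExtend_of_mem _ _ ⟨hs.1, hs.2.trans t.2.2⟩, ouSeq_succ_apply hβ]
  have hc : Continuous (ouSol β l) :=
    continuous_iff_continuousAt.2 fun t => (hasDerivAt_ouSol hβ l t).continuousAt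
  -- The antiderivative comes from `y = (cos (l s) - y') / β`.
  have hint := intervalIntegral.integral_eq_sub_of_hasDerivAt (a := 0) (b := t)
    (f := fun s => (1 / β) * (Real.sin (l * s) / l - ouSol β l s)) (f' := ouSol β l) (fun s _ => by
      have h1 : HasDerivAt (fun t => l * t) l s := by simpa using (hasDerivAt_id s).const_mul l
      refine (((h1.sin.div_const l).sub (hasDerivAt_ouSol hβ l s)).const_mul _).congr_deriv ?_
      field_simp
      ring) (hc.intervalIntegrable _ _)
  rw [intervalIntegral.integral_congr h, intervalIntegral.integral_const_mul, hint,
    ouSeq_succ_apply hβ, ouSeq_succ_apply hβ]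
  have h0 : ouSol β l 0 = 0 := by simp [ouSol]
  simp only [← hldef, h0, mul_zero, Real.sin_zero, zero_div, sub_zero]
  field_simp
  ring

lemma ouSeq_succ_apply_zero (hT : 0 ≤ T) (hβ : 0 < β) (j : ℕ) :
    ouSeq T β σ (j + 1) ⟨0, Set.left_mem_Icc.2 hT⟩ = 0 := by
  rw [ouSeq_succ_apply hβ]
  simp [ouSol]

end Noise

/-! ### Identifying Gaussian laws -/

section CramerWold

/-- A probability measure on sequences is determined by the laws of finite linear combinations of
the coordinates. -/
lemma Measure.ext_of_map_sum {μ ν : Measure (ℕ → ℝ)} [IsProbabilityMeasure μ]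
    [IsProbabilityMeasure ν] (h : ∀ (N : ℕ) (a : ℕ → ℝ),
      μ.map (fun x => ∑ i ∈ Finset.range (N + 1), a i * x i) =
        ν.map (fun x => ∑ i ∈ Finset.range (N + 1), a i * x i)) : μ = ν := by
  have key : ∀ I : Finset ℕ, μ.map I.restrict = ν.map I.restrict := by
    intro I
    have : IsProbabilityMeasure (μ.map I.restrict) :=
      Measure.isProbabilityMeasure_map (Finset.measurable_restrict I).aemeasurable
    have : IsProbabilityMeasure (ν.map I.restrict) :=
      Measure.isProbabilityMeasure_map (Finset.measurable_restrict I).aemeasurable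
    refine Measure.ext_of_charFunDual (funext fun L => ?_)
    have hLm : Measurable L := L.continuous.measurable
    rw [charFunDual_eq_charFun_map_one, charFunDual_eq_charFun_map_one,
      Measure.map_map hLm (Finset.measurable_restrict I),
      Measure.map_map hLm (Finset.measurable_restrict I)]
    -- A functional of the coordinates in `I` is a combination over an initial segment, with
    -- coefficients `0` off `I`.
    have hL : (L ∘ I.restrict : (ℕ → ℝ) → ℝ) = fun x => ∑ i ∈ Finset.range (I.sup id + 1),
        (if hi : i ∈ I then L (fun j => if (⟨i, hi⟩ : I) = j then 1 else 0) else 0) * x i := by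
      ext x
      have h1 : L (I.restrict x) = ∑ i : I, x i * L (fun j => if i = j then 1 else 0) := by
        have := LinearMap.pi_apply_eq_sum_univ (L : (I → ℝ) →ₗ[ℝ] ℝ) (I.restrict x)
        simpa [Finset.restrict] using this
      have h2 : I ⊆ Finset.range (I.sup id + 1) := fun i hi =>
        Finset.mem_range.2 (Nat.lt_succ_of_le (Finset.le_sup (f := id) hi))
      rw [Function.comp_apply, h1, ← Finset.sum_subset h2 (fun i _ hi => by simp [hi]),
        ← Finset.sum_coe_sort I]
      exact Finset.sum_congr rfl fun i _ => by simp [mul_comm]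
    rw [hL, h]
  have hμ : IsProjectiveLimit μ (fun I : Finset ℕ => μ.map I.restrict) := fun I => rfl
  have hν : IsProjectiveLimit ν (fun I : Finset ℕ => μ.map I.restrict) := fun I => (key I).symm
  have : ∀ I : Finset ℕ, IsProbabilityMeasure (μ.map I.restrict) := fun I =>
    Measure.isProbabilityMeasure_map (Finset.measurable_restrict I).aemeasurable
  exact hμ.unique hν

/-- The characteristic functions converge to that of `Z` by dominated convergence, and to the
Gaussian one because the variances converge. -/
lemma hasLaw_of_tendsto_gaussianReal {Ω : Type*} [MeasurableSpace Ω] {Q : Measure Ω}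
    [IsProbabilityMeasure Q] {Y : ℕ → Ω → ℝ} {Z : Ω → ℝ} {v : ℕ → ℝ} {w : ℝ} (hv : ∀ n, 0 ≤ v n)
    (hY : ∀ n, HasLaw (Y n) (gaussianReal 0 (v n).toNNReal) Q)
    (hlim : ∀ᵐ ω ∂Q, Tendsto (fun n => Y n ω) atTop (𝓝 (Z ω))) (hw : Tendsto v atTop (𝓝 w)) :
    HasLaw Z (gaussianReal 0 w.toNNReal) Q := by
  have hZ : AEMeasurable Z Q :=
    aemeasurable_of_tendsto_metrizable_ae atTop (fun n => (hY n).aemeasurable) hlim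
  have hw0 : 0 ≤ w := ge_of_tendsto' hw hv
  refine ⟨hZ, ?_⟩
  have := Measure.isProbabilityMeasure_map hZ (μ := Q)
  refine Measure.ext_of_charFun (funext fun t => ?_)
  have hmap : ∀ U : Ω → ℝ, AEMeasurable U Q →
      charFun (Q.map U) t = ∫ ω, Complex.exp (t * U ω * Complex.I) ∂Q := by
    intro U hU
    rw [charFun_apply_real, integral_map hU (by fun_prop)]
  have h1 : Tendsto (fun n => charFun (Q.map (Y n)) t) atTop (𝓝 (charFun (Q.map Z) t)) := by
    rw [hmap Z hZ]
    simp_rw [fun n => hmap (Y n) (hY n).aemeasurable]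
    refine tendsto_integral_of_dominated_convergence (fun _ => 1) (fun n => ?_)
      (integrable_const _) (fun n => Eventually.of_forall fun ω => ?_) ?_
    · have := (hY n).aemeasurable
      exact AEMeasurable.aestronglyMeasurable (by fun_prop)
    · rw [← Complex.ofReal_mul, Complex.norm_exp_ofReal_mul_I]
    · filter_upwards [hlim] with ω hω
      have hc : Continuous fun x : ℝ => Complex.exp (t * x * Complex.I) := by fun_prop
      exact (hc.tendsto _).comp hω
  have h2 : Tendsto (fun n => charFun (Q.map (Y n)) t) atTop
      (𝓝 (charFun (gaussianReal 0 w.toNNReal) t)) := by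
    simp_rw [fun n => (hY n).map_eq, charFun_gaussianReal, Real.coe_toNNReal _ hw0,
      fun n => Real.coe_toNNReal _ (hv n)]
    have hc : Continuous fun x : ℝ => Complex.exp (t * (0 : ℝ) * Complex.I - x * t ^ 2 / 2) := by
      fun_prop
    exact (hc.tendsto _).comp hw
  exact tendsto_nhds_unique h1 h2

lemma SumsTo.hasLaw_clm {Ω E : Type*} [MeasurableSpace Ω] {Q : Measure Ω} [NormedAddCommGroup E]
    [NormedSpace ℝ E] {ξ : ℕ → Ω → ℝ} (hξ : IsStdNormalSeq ξ Q) {f : ℕ → E} {S : Ω → E}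
    (hS : SumsTo ξ Q f S) (L : E →L[ℝ] ℝ) {w : ℝ} (hw : HasSum (fun j => L (f j) ^ 2) w) :
    HasLaw (fun ω => L (S ω)) (gaussianReal 0 w.toNNReal) Q := by
  have := hξ.isProbabilityMeasure
  refine hasLaw_of_tendsto_gaussianReal (fun n => Finset.sum_nonneg fun j _ => sq_nonneg _)
    (fun n => hξ.hasLaw_sum (fun j => L (f j)) (Finset.range n)) ?_ hw.tendsto_sum_nat
  filter_upwards [hS] with ω hω
  refine ((L.continuous.tendsto _).comp hω).congr fun n => ?_
  simp [mul_comm]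

end CramerWold

/-! ### Linear combinations of Brownian values -/

section BrownianCombination

variable {Ω : Type*} [MeasurableSpace Ω] {P : Measure Ω} {W : ℝ≥0 → Ω → ℝ}

lemma IsPreBrownianReal.hasGaussianLaw_sum (hW : IsPreBrownianReal W P) (t : ℕ → ℝ≥0)
    (a : ℕ → ℝ) (N : ℕ) :
    HasGaussianLaw (fun ω => ∑ k ∈ Finset.range N, a k * W (t k) ω) P :=
  ((hW.isGaussianProcess.comp_right t).smul a).hasGaussianLaw_fun_sum

lemma IsPreBrownianReal.variance_sum (hW : IsPreBrownianReal W P) (t : ℕ → ℝ≥0) (a : ℕ → ℝ)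
    (N : ℕ) : Var[fun ω => ∑ k ∈ Finset.range N, a k * W (t k) ω; P] =
      ∑ k ∈ Finset.range N, ∑ l ∈ Finset.range N, a k * a l * min (t k : ℝ) (t l) := by
  have := hW.isGaussianProcess.isProbabilityMeasure
  have hL2 : ∀ k, MemLp (fun ω => a k * W (t k) ω) 2 P := fun k =>
    (hW.isGaussianProcess.hasGaussianLaw_eval (t k)).memLp_two.const_mul _
  rw [← covariance_self (IsPreBrownianReal.hasGaussianLaw_sum hW t a N).aemeasurable,
    covariance_fun_sum_fun_sum' (fun k _ => hL2 k) (fun k _ => hL2 k)]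
  refine Finset.sum_congr rfl fun k _ => Finset.sum_congr rfl fun l _ => ?_
  rw [covariance_const_mul_left, covariance_const_mul_right, hW.covariance_fun_eval]
  push_cast
  ring

lemma IsPreBrownianReal.hasLaw_sum (hW : IsPreBrownianReal W P) (t : ℕ → ℝ≥0) (a : ℕ → ℝ)
    (N : ℕ) :
    HasLaw (fun ω => ∑ k ∈ Finset.range N, a k * W (t k) ω) (gaussianReal 0
      (∑ k ∈ Finset.range N, ∑ l ∈ Finset.range N, a k * a l * min (t k : ℝ) (t l)).toNNReal) P := by
  have hG := IsPreBrownianReal.hasGaussianLaw_sum hW t a N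
  refine ⟨hG.aemeasurable, ?_⟩
  rw [hG.map_eq_gaussianReal, integral_finsetSum _ fun k _ => (hW.integrable_eval _).const_mul _,
    IsPreBrownianReal.variance_sum hW]
  congr 1
  simp [integral_const_mul, hW.integral_eval]

end BrownianCombination

/-! ### Laws of the noise coordinates -/

section Law

variable {T β σ : ℝ}

/-- A dense sequence in `[0, T]`. -/
noncomputable def timeSeq (hT : 0 ≤ T) : ℕ → Set.Icc (0 : ℝ) T :=
  haveI : Nonempty (Set.Icc (0 : ℝ) T) := ⟨⟨0, Set.left_mem_Icc.2 hT⟩⟩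
  TopologicalSpace.denseSeq _

lemma denseRange_timeSeq (hT : 0 ≤ T) : DenseRange (timeSeq hT) :=
  haveI : Nonempty (Set.Icc (0 : ℝ) T) := ⟨⟨0, Set.left_mem_Icc.2 hT⟩⟩
  TopologicalSpace.denseRange_denseSeq _

/-- The initial value of a path, and its Langevin noise along a dense sequence of times. -/
noncomputable def langevinCoord (hT : 0 ≤ T) (β : ℝ) : ℕ → PathSpace T →L[ℝ] ℝ
  | 0 => ContinuousMap.evalCLM ℝ ⟨0, Set.left_mem_Icc.2 hT⟩
  | k + 1 => langevinNoise hT β (timeSeq hT k)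

/-- A continuous injection between Polish spaces is a measurable embedding, so the law of a path can
be read off its coordinates. Injectivity: continuity extends equality of noises from the dense times
to all times. -/
lemma measurableEmbedding_langevinCoord (hT : 0 ≤ T) :
    MeasurableEmbedding fun (x : PathSpace T) k => langevinCoord hT β k x := by
  refine Continuous.measurableEmbedding (continuous_pi fun k => (langevinCoord hT β k).continuous)
    fun x y hxy => sub_eq_zero.1 (eq_zero_of_langevinNoise_eq_zero (β := β) hT ?_ fun t => ?_)
  · have := congrFun hxy 0
    exact sub_eq_zero.2 this
  · have h1 : (fun t => langevinNoise hT β t (x - y)) = fun _ => 0 := by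
      refine (denseRange_timeSeq hT).equalizer (continuous_langevinNoise hT _) continuous_const ?_
      ext k
      have := congrFun hxy (k + 1)
      simp only [Function.comp_apply, map_sub]
      exact sub_eq_zero.2 this
    exact congrFun h1 t

/-- The variance of linear combinations of the coordinates `langevinCoord` of an
Ornstein–Uhlenbeck process. -/
noncomputable def coordVar (hT : 0 ≤ T) (β σ : ℝ) (a : ℕ → ℝ) (N : ℕ) : ℝ :=
  a 0 ^ 2 * (σ ^ 2 / (2 * β)) + σ ^ 2 * ∑ k ∈ Finset.range N, ∑ l ∈ Finset.range N,
    a (k + 1) * a (l + 1) * min (timeSeq hT k : ℝ) (timeSeq hT l)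

/-- The two parts of the variance decouple: `f_0` has no noise, and the other `f_j` vanish at time
`0`. -/
lemma hasSum_coord_ouSeq_sq (hT : 0 < T) (hβ : 0 < β) (a : ℕ → ℝ) (N : ℕ) :
    HasSum (fun j => (∑ i ∈ Finset.range (N + 1), a i • langevinCoord hT.le β i) (ouSeq T β σ j) ^ 2)
      (coordVar hT.le β σ a N) := by
  have happly : ∀ x, (∑ i ∈ Finset.range (N + 1), a i • langevinCoord hT.le β i) x =
      (∑ k ∈ Finset.range N, a (k + 1) * langevinNoise hT.le β (timeSeq hT.le k) x) +
        a 0 * x ⟨0, Set.left_mem_Icc.2 hT.le⟩ := by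
    intro x
    rw [Finset.sum_range_succ', _root_.add_apply, _root_.sum_apply]
    rfl
  rw [← hasSum_nat_add_iff' 1]
  simp only [Finset.sum_range_one, happly, langevinNoise_ouSeq_zero hT.le hβ, mul_zero,
    Finset.sum_const_zero, langevinNoise_ouSeq_succ hT hβ, ouSeq_succ_apply_zero hT.le hβ, add_zero,
    zero_add, ouSeq_zero_apply, Real.exp_zero, mul_one]
  have h1 : HasSum (fun j => ∑ k ∈ Finset.range N, ∑ l ∈ Finset.range N, a (k + 1) * a (l + 1) *
      (√(2 / T) * (Real.sin (ouFreq T j * timeSeq hT.le k) / ouFreq T j) *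
      (√(2 / T) * (Real.sin (ouFreq T j * timeSeq hT.le l) / ouFreq T j))))
      (∑ k ∈ Finset.range N, ∑ l ∈ Finset.range N,
        a (k + 1) * a (l + 1) * min (timeSeq hT.le k : ℝ) (timeSeq hT.le l)) :=
    hasSum_sum fun k _ => hasSum_sum fun l _ =>
      (hasSum_sin_mul_sin hT (timeSeq hT.le k).2 (timeSeq hT.le l).2).mul_left _
  refine (h1.mul_left (σ ^ 2)).of_eq (fun j => ?_) ?_
  · rw [sq (∑ k ∈ Finset.range N, _), Finset.sum_mul_sum, Finset.mul_sum]
    refine Finset.sum_congr rfl fun k _ => ?_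
    rw [Finset.mul_sum]
    refine Finset.sum_congr rfl fun l _ => ?_
    ring
  · rw [coordVar, mul_pow, div_pow, Real.sq_sqrt (by positivity)]
    ring

/-- By the Langevin equation the noise coordinates are values of `σ W`, independent of the initial
value. -/
lemma IsStationaryOU.hasLaw_coord {Ω : Type*} [MeasurableSpace Ω] {P : Measure Ω} (hT : 0 ≤ T)
    (hβ : 0 < β) {X : Ω → PathSpace T} (hX : IsStationaryOU hT β σ X P) (a : ℕ → ℝ)
    (N : ℕ) :
    HasLaw (fun ω => ∑ i ∈ Finset.range (N + 1), a i * langevinCoord hT β i (X ω))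
      (gaussianReal 0 (coordVar hT β σ a N).toNNReal) P := by
  obtain ⟨W, hW, hind, heq⟩ := hX.langevin
  have hX0 := hX.law_zero
  set X0 : Ω → ℝ := fun ω => X ω ⟨0, Set.left_mem_Icc.2 hT⟩
  set G : Ω → ℝ := fun ω => ∑ k ∈ Finset.range N, a (k + 1) * W (timeSeq hT k : ℝ).toNNReal ω with hG
  have hGlaw : HasLaw G _ P := IsPreBrownianReal.hasLaw_sum hW.toIsPreBrownianReal
    (fun k => (timeSeq hT k : ℝ).toNNReal) (fun k => a (k + 1)) N
  have h1 := gaussianReal_const_mul hX0 (a 0)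
  have h2 := gaussianReal_const_mul hGlaw σ
  have hi : IndepFun (fun ω => a 0 * X0 ω) (fun ω => σ * G ω) P :=
    hind.comp (φ := fun x => a 0 * x) (ψ := fun w : ℝ≥0 → ℝ => σ * ∑ k ∈ Finset.range N,
      a (k + 1) * w (timeSeq hT k : ℝ).toNNReal) (by fun_prop) (by fun_prop)
  have h3 := gaussianReal_add_gaussianReal_of_indepFun hi h1.map_eq h2.map_eq
  have hae : (fun ω => ∑ i ∈ Finset.range (N + 1), a i * langevinCoord hT β i (X ω)) =ᵐ[P]
      (fun ω => a 0 * X0 ω) + fun ω => σ * G ω := by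
    filter_upwards [heq] with ω hω
    rw [Finset.sum_range_succ', Pi.add_apply, add_comm, hG, Finset.mul_sum]
    congr 1
    refine Finset.sum_congr rfl fun k _ => ?_
    have h4 : langevinCoord hT β (k + 1) (X ω) = σ * W (timeSeq hT k : ℝ).toNNReal ω := by
      rw [langevinCoord, langevinNoise_apply, hω (timeSeq hT k)]
      ring
    rw [h4]
    ring
  have h5 : HasLaw ((fun ω => a 0 * X0 ω) + fun ω => σ * G ω)
      (gaussianReal 0 (coordVar hT β σ a N).toNNReal) P := by
    refine ⟨h1.aemeasurable.add h2.aemeasurable, h3.trans ?_⟩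
    rw [mul_zero, mul_zero, add_zero]
    congr 1
    have hV := variance_nonneg G P
    rw [hG, IsPreBrownianReal.variance_sum hW.toIsPreBrownianReal] at hV
    simp only [Real.coe_toNNReal _ (timeSeq hT _).2.1] at hV ⊢
    ext
    rw [NNReal.coe_add, NNReal.coe_mul, NNReal.coe_mul, Real.coe_toNNReal _ hV,
      Real.coe_toNNReal _ (by positivity), coordVar, Real.coe_toNNReal _ (by positivity)]
    rfl
  exact h5.congr hae

end Law

/-! ### Admissibility and the quantization rate -/

section Main

variable {T β σ : ℝ}

lemma aemeasurable_of_forall_langevinCoord {Ω : Type*} [MeasurableSpace Ω] {P : Measure Ω}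
    (hT : 0 ≤ T) {X : Ω → PathSpace T}
    (hX : ∀ (a : ℕ → ℝ) (N : ℕ), AEMeasurable
      (fun ω => ∑ i ∈ Finset.range (N + 1), a i * langevinCoord hT β i (X ω)) P) :
    AEMeasurable X P := by
  refine (measurableEmbedding_langevinCoord (β := β) hT).aemeasurable_comp_iff.1
    (aemeasurable_pi_lambda _ fun k => ?_)
  have h := hX (Pi.single k 1) k
  convert h using 2 with ω
  simp [Pi.single_apply]

lemma identDistrib_of_forall_langevinCoord {Ω Ω' : Type*} [MeasurableSpace Ω] [MeasurableSpace Ω']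
    {P : Measure Ω} {Q : Measure Ω'} [IsProbabilityMeasure P] [IsProbabilityMeasure Q]
    (hT : 0 ≤ T) {X : Ω → PathSpace T} {S : Ω' → PathSpace T} (μ : (ℕ → ℝ) → ℕ → Measure ℝ)
    (hX : ∀ (a : ℕ → ℝ) (N : ℕ), HasLaw
      (fun ω => ∑ i ∈ Finset.range (N + 1), a i * langevinCoord hT β i (X ω)) (μ a N) P)
    (hS : ∀ (a : ℕ → ℝ) (N : ℕ), HasLaw
      (fun ω => ∑ i ∈ Finset.range (N + 1), a i * langevinCoord hT β i (S ω)) (μ a N) Q) :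
    IdentDistrib X S P Q := by
  have hXm := aemeasurable_of_forall_langevinCoord hT fun a N => (hX a N).aemeasurable
  have hSm := aemeasurable_of_forall_langevinCoord hT fun a N => (hS a N).aemeasurable
  have hΘ := measurableEmbedding_langevinCoord (β := β) hT
  refine ⟨hXm, hSm, hΘ.map_injective ?_⟩
  have := Measure.isProbabilityMeasure_map (μ := P) hXm
  have := Measure.isProbabilityMeasure_map (μ := Q) hSm
  have := Measure.isProbabilityMeasure_map (μ := P.map X) hΘ.measurable.aemeasurable
  have := Measure.isProbabilityMeasure_map (μ := Q.map S) hΘ.measurable.aemeasurable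
  refine Measure.ext_of_map_sum fun N a => ?_
  have hm : Measurable fun x : ℕ → ℝ => ∑ i ∈ Finset.range (N + 1), a i * x i := by fun_prop
  rw [Measure.map_map hm hΘ.measurable, Measure.map_map hm hΘ.measurable,
    AEMeasurable.map_map_of_aemeasurable (hm.comp hΘ.measurable).aemeasurable hXm,
    AEMeasurable.map_map_of_aemeasurable (hm.comp hΘ.measurable).aemeasurable hSm]
  exact (hX a N).map_eq.trans (hS a N).map_eq.symm

lemma IsStationaryOU.identDistrib {Ω Ω' : Type*} [MeasurableSpace Ω] [MeasurableSpace Ω']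
    {P : Measure Ω} {Q : Measure Ω'} [IsProbabilityMeasure P] (hT : 0 < T)
    (hβ : 0 < β) {X : Ω → PathSpace T} {ξ : ℕ → Ω' → ℝ} (hX : IsStationaryOU hT.le β σ X P)
    (hξ : IsStdNormalSeq ξ Q) {S : Ω' → PathSpace T} (hS : SumsTo ξ Q (ouSeq T β σ) S) :
    IdentDistrib X S P Q := by
  have := hξ.isProbabilityMeasure
  refine identDistrib_of_forall_langevinCoord hT.le _ (hX.hasLaw_coord hT.le hβ) fun a N => ?_
  have h := hS.hasLaw_clm hξ _ (hasSum_coord_ouSeq_sq (σ := σ) hT hβ a N)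
  simpa using h

lemma isAdmissible_ouSeq {Ω Ω' : Type*} [MeasurableSpace Ω] [MeasurableSpace Ω']
    {P : Measure Ω} {Q : Measure Ω'} [IsProbabilityMeasure P] (hT : 0 < T)
    (hβ : 0 < β) (hσ : 0 < σ) {X : Ω → PathSpace T} {ξ : ℕ → Ω' → ℝ}
    (hX : IsStationaryOU hT.le β σ X P) (hξ : IsStdNormalSeq ξ Q) :
    IsAdmissible ξ Q X P (ouSeq T β σ) := by
  obtain ⟨C, hC, h1, h2⟩ := exists_norm_ouSeq_le hT hβ hσ
  obtain ⟨K, B, -, h3⟩ := exists_forall_norm_sum_Ico_le hT hC h1 h2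
  obtain ⟨Λ, -, -, -, h4⟩ := h3 Q ξ hξ
  obtain ⟨S, hS⟩ := exists_sumsTo h4
  exact ⟨S, hS, hX.identDistrib hT hβ hξ hS⟩

/-- With precision `m ^ (-p)` per coordinate, the total is `m ^ (r + 1 - p r) ≤ m ^ (-r)`, which is
below the tail. -/
lemma rpow_mul_one_div_pow_le {r : ℝ} (hr : 0 < r) {p m : ℕ} (hp : 1 / r + 2 ≤ p) (hm : 3 ≤ m) :
    (m : ℝ) ^ r * (m * (1 / (m ^ p : ℕ) : ℝ) ^ r) ≤ √(Real.log (m + 1) / m) ^ r := by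
  have hm' : (3 : ℝ) ≤ m := by exact_mod_cast hm
  have hm0 : (0 : ℝ) < m := by linarith
  have hlog : 1 ≤ Real.log ((m : ℝ) + 1) := by
    rw [Real.le_log_iff_exp_le (by positivity)]
    linarith [Real.exp_one_lt_d9]
  have hpr : 1 + 2 * r ≤ p * r := by
    have := mul_le_mul_of_nonneg_right hp hr.le
    rwa [add_mul, one_div_mul_cancel hr.ne'] at this
  calc (m : ℝ) ^ r * (m * (1 / (m ^ p : ℕ) : ℝ) ^ r) = (m : ℝ) ^ (r + (1 + -(p * r))) := by
        rw [Real.rpow_add hm0, Real.rpow_add hm0, Real.rpow_one, Real.rpow_neg hm0.le, one_div,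
          Real.inv_rpow (by positivity), Real.rpow_mul hm0.le, Real.rpow_natCast]
        push_cast
        rfl
    _ ≤ (m : ℝ) ^ (-(1 / 2) * r) := Real.rpow_le_rpow_of_exponent_le (by linarith) (by linarith)
    _ = √(1 / m) ^ r := by
        rw [Real.rpow_mul hm0.le, Real.rpow_neg hm0.le, ← Real.sqrt_eq_rpow, one_div,
          Real.sqrt_inv]
    _ ≤ _ := by gcongr

/-- The rate of product quantization for sequences satisfying (A1) with `ϑ = 1`, `γ = 0` and (A2)
with `a = b = 1`. -/
theorem exists_minProdQuantError_le {f : ℕ → PathSpace T} {C : ℝ} (hT : 0 < T) (hC : 0 < C)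
    (hf : ∀ j : ℕ, ‖f j‖ ≤ C / (j + 1))
    (hf' : ∀ (j : ℕ) (s t : Set.Icc (0 : ℝ) T), |f j s - f j t| ≤ C * (j + 1) * |(s : ℝ) - t|)
    {r : ℝ} (hr : 0 < r) :
    ∃ A : ℝ, ∀ᶠ N : ℕ in atTop,
      ∀ (Ω Ω' : Type*) [MeasurableSpace Ω] [MeasurableSpace Ω']
        (P : Measure Ω) (Q : Measure Ω') (X : Ω → PathSpace T) (ξ : ℕ → Ω' → ℝ),
        IsStdNormalSeq ξ Q → IsAdmissible ξ Q X P f →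
          minProdQuantError ξ Q X P N r ≤
            ENNReal.ofReal (A * (Real.log (Real.log N) / Real.log N ^ (1 / 2 : ℝ))) := by
  obtain ⟨K, B, hK, h3⟩ := exists_forall_norm_sum_Ico_le hT hC hf hf'
  obtain ⟨c₁, hc₁, hc₁'⟩ := exists_one_add_rpow_le_mul_exp r
  obtain ⟨c₂, hc₂, hc₂'⟩ := exists_lintegral_optimal_le hr
  set p : ℕ := ⌈1 / r⌉₊ + 2 with hp
  have hp' : 1 / r + 2 ≤ p := by
    rw [hp]
    push_cast
    linarith [Nat.le_ceil (1 / r)]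
  set D : ℝ := 2 ^ r * (c₁ * K ^ r * B + c₂ * C ^ r) with hD
  refine ⟨D ^ (1 / r) * (2 * √(2 * p + 2 : ℕ)), ?_⟩
  filter_upwards [eventually_exists_product_level (q := 2 * p + 2) (by omega)] with N hN
  intro Ω Ω' _ _ P Q X ξ hξ hadm
  have := hξ.isProbabilityMeasure
  obtain ⟨m, hm3, hmN, hφ⟩ := hN
  obtain ⟨S, hS, hXS⟩ := id hadm
  obtain ⟨Λ, hΛm, hΛ0, hΛ, h4⟩ := h3 Q ξ hξ
  have hM1 : 1 ≤ m ^ (2 * p + 2) := Nat.one_le_pow _ _ (by omega)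
  choose ξhat hξhat using fun j => exists_isOptimalQuantization (hξ.1 j) hr
    (lintegral_enorm_rpow_gaussianReal_lt_top hr) hM1
  have hprod : IsProductQuantization ξ Q f N r fun ω => ∑ j ∈ Finset.range m, ξhat j ω • f j := by
    refine ⟨m, fun _ => m ^ (2 * p + 2), ξhat, by omega, fun _ _ => hM1, ?_, fun j _ => hξhat j, rfl⟩
    simpa using hmN
  refine iInf₂_le_of_le f hadm (iInf₂_le_of_le S hS (iInf₂_le_of_le _ hprod ?_))
  set φ := √(Real.log (m + 1) / m)
  have ha := lintegral_enorm_rpow_le hr hK hΛ0 hΛ hc₁ hc₁' hm3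
    ((hS.norm_sub_le h4).mono fun ω h => h m hm3)
  -- The exponent `q = 2p + 2` leaves room for a grid quantizer with `s = m ^ p`.
  have hs : 2 * (m ^ p) ^ 2 + 1 ≤ m ^ (2 * p + 2) := by
    have h1 : 1 ≤ m ^ (2 * p) := Nat.one_le_pow _ _ (by omega)
    have h2 : 3 ^ 2 ≤ m ^ 2 := Nat.pow_le_pow_left hm3 2
    rw [← pow_mul, mul_comm p 2, pow_add]
    nlinarith
  have hb : ∀ j < m, _ := fun j _ => hc₂' Q (ξ j) (ξhat j) (m ^ p) _ (hξ.1 j)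
    (Nat.one_le_pow _ _ (by omega)) hs (hξhat j)
  have hfC : ∀ j, ‖f j‖ ≤ C := fun j => (hf j).trans
    (div_le_self hC.le (by linarith [Nat.cast_nonneg (α := ℝ) j]))
  have htotal := lintegral_sub_sum_rpow_le hr hfC hξ.aemeasurable
    (fun j _ => (hξhat j).1.1.aemeasurable) ha hb
  have hD' : ∫⁻ ω, ‖S ω - ∑ j ∈ Finset.range m, ξhat j ω • f j‖ₑ ^ r ∂Q ≤
      ENNReal.ofReal (D * φ ^ r) := by
    refine htotal.trans ?_
    have hB : (B : ℝ≥0∞) = ENNReal.ofReal B := (ENNReal.ofReal_coe_nnreal).symm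
    have h2 : (2 : ℝ≥0∞) ^ r = ENNReal.ofReal (2 ^ r) := by
      rw [← ENNReal.ofReal_rpow_of_pos two_pos, ENNReal.ofReal_ofNat]
    have hmr : (m : ℝ≥0∞) ^ r = ENNReal.ofReal ((m : ℝ) ^ r) := by
      rw [← ENNReal.ofReal_rpow_of_nonneg (Nat.cast_nonneg m) hr.le, ENNReal.ofReal_natCast]
    rw [hB, h2, hmr, ← ENNReal.ofReal_natCast m, ENNReal.ofReal_rpow_of_pos hC,
      ← ENNReal.ofReal_mul (by positivity), ← ENNReal.ofReal_mul (by positivity),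
      ← ENNReal.ofReal_mul (by positivity), ← ENNReal.ofReal_mul (by positivity),
      ← ENNReal.ofReal_add (by positivity) (by positivity), ← ENNReal.ofReal_mul (by positivity)]
    refine ENNReal.ofReal_le_ofReal ?_
    have h5 := mul_le_mul_of_nonneg_left (rpow_mul_one_div_pow_le hr hp' hm3)
      (by positivity : 0 ≤ c₂ * C ^ r)
    calc _ = 2 ^ r * (c₁ * K ^ r * φ ^ r * B + c₂ * C ^ r *
          ((m : ℝ) ^ r * (m * (1 / (m ^ p : ℕ) : ℝ) ^ r))) := by ring
      _ ≤ 2 ^ r * (c₁ * K ^ r * φ ^ r * B + c₂ * C ^ r * φ ^ r) := by gcongr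
      _ = D * φ ^ r := by ring
  have hφ0 : 0 ≤ φ := Real.sqrt_nonneg _
  have hD0 : 0 ≤ D := by positivity
  calc lrError S _ Q r ≤ ENNReal.ofReal (D * φ ^ r) ^ (1 / r) :=
        ENNReal.rpow_le_rpow hD' (by positivity)
    _ = ENNReal.ofReal (D ^ (1 / r) * φ) := by
        rw [ENNReal.ofReal_rpow_of_nonneg (by positivity) (by positivity),
          Real.mul_rpow hD0 (by positivity), ← Real.rpow_mul hφ0, mul_one_div_cancel hr.ne',
          Real.rpow_one]
    _ ≤ _ := by
        refine ENNReal.ofReal_le_ofReal ?_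
        rw [mul_assoc]
        gcongr

end Main

theorem mainTheorem6 (T β σ : ℝ) (hT : 0 < T) (hβ : 0 < β) (hσ : 0 < σ) :
    SatisfiesA1 (ouSeq T β σ) 1 0 ∧ SatisfiesA2 (ouSeq T β σ) 1 1 ∧
    (∀ (Ω Ω' : Type*) [MeasurableSpace Ω] [MeasurableSpace Ω']
      (P : Measure Ω) [IsProbabilityMeasure P] (Q : Measure Ω') [IsProbabilityMeasure Q]
      (X : Ω → PathSpace T) (ξ : ℕ → Ω' → ℝ),
      IsStationaryOU hT.le β σ X P → IsStdNormalSeq ξ Q →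
        IsAdmissible ξ Q X P (ouSeq T β σ)) ∧
    ∀ r : ℝ, 0 < r → ∃ C : ℝ, ∀ᶠ N : ℕ in atTop,
      ∀ (Ω Ω' : Type*) [MeasurableSpace Ω] [MeasurableSpace Ω']
        (P : Measure Ω) [IsProbabilityMeasure P] (Q : Measure Ω') [IsProbabilityMeasure Q]
        (X : Ω → PathSpace T) (ξ : ℕ → Ω' → ℝ),
        IsStationaryOU hT.le β σ X P → IsStdNormalSeq ξ Q →
          minProdQuantError ξ Q X P N r ≤
            ENNReal.ofReal (C * (Real.log (Real.log N) / Real.log N ^ (1 / 2 : ℝ))) := by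
  refine ⟨satisfiesA1_ouSeq hT hβ hσ, satisfiesA2_ouSeq hT hβ hσ, ?_, fun r hr => ?_⟩
  · intro Ω Ω' _ _ P _ Q _ X ξ hX hξ
    exact isAdmissible_ouSeq hT hβ hσ hX hξ
  · obtain ⟨C, hC, h1, h2⟩ := exists_norm_ouSeq_le hT hβ hσ
    obtain ⟨A, hA⟩ := exists_minProdQuantError_le hT hC h1 h2 hr
    refine ⟨A, hA.mono fun N hN => ?_⟩
    intro Ω Ω' _ _ P _ Q _ X ξ hX hξ
    exact hN Ω Ω' P Q X ξ hξ (isAdmissible_ouSeq hT hβ hσ hX hξ)
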